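/- **Setting.** Let $\mathcal O=\mathbb C[[z]]$, $\mathcal K=\mathbb C((z))$, let $\mathrm{Der}\,\mathcal K=\mathcal K\partial_z$ be the Lie algebra of continuous derivations of $\mathcal K$, and put $L_n=-z^{n+1}\partial_z$, so that $[L_m,L_n]=(m-n)L_{m+n}$, and $L(t)=\sum_{n\in\mathbb Z}L_nt^{-n-2}$. A $(\mathrm{Der}\,\mathcal K,\mathrm{Aut}\,\mathcal O)$-module is a complex vector space $V$ with an action of the Lie algebra $\mathrm{Der}\,\mathcal K$ that is continuous for the discrete topology of $V$ (each $v\in V$ is killed by $z^N\mathcal O\partial_z$ for some $N$) and a linear action of the group $\mathrm{Aut}\,\mathcal O$ such that $\rho\cdot(D\cdot v)=(\rho D\rho^{-1})\cdot(\rho\cdot v)$ and such that the differential of the action of $\mathrm{Aut}\,\mathcal O$ is the restriction of the action of $\mathrm{Der}\,\mathcal K$ to $\mathrm{Lie}(\mathrm{Aut}\,\mathcal O)=z\mathcal O\partial_z$. Let $E\to\mathbb H$ be the quotient of $\mathbb H\times\mathbb C$ by the action $(m,n):(\tau,z)\mapsto(\tau,z+m\tau+n)$ of $\mathbb Z^2$,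 with marked point $z=0$ in each fibre $E_\tau$. Vector fields on $E$ are understood to be holomorphic away from the zero section and meromorphic along it. Let $Z=\mathbb H\times\mathrm{Aut}\,\mathcal O$ be the principal $\mathrm{Aut}\,\mathcal O$-bundle over $\mathbb H$ of pairs $(\tau,t)$ with $t\in z\mathbb C[[z]]$ a formal coordinate on $E_\tau$ at $0$; $\mathrm{Der}\,\mathcal K$ acts on it by $\alpha:\mathrm{Der}\,\mathcal K\to\Theta_Z$, where for a vector field $a(\tau)\partial_\tau+h(\tau,z)\partial_z$ on $E$ the map $\alpha$ sends the expansion of $h\partial_z$ in powers of $t$ to the tangent vector of $Z$ at $(\tau,t)$ that lifts $a(\tau)\partial_\tau$ and leaves $t$ unchanged as a power series in $z$ (and $\alpha$ extends the infinitesimal right action of $\mathrm{Aut}\,\mathcal O$ on $Z$). The Harish-Chandra localisation $\Delta(V)$ is the sheaf $\mathcal V/\mathfrak g^0\cdot\mathcal V$ on $\mathbb H$, where $\mathcal V$ is the sheaf of holomorphic sections (in the trivialisation by $t=z$: functions that are locally finite sums $\sum f_i(\tau)v_i$ with $f_i$ holomorphic and $v_i\in V$) of $Z\times_{\mathrm{Aut}\,\mathcal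 O}V$, $(zg,v)\sim(z,gv)$, and $\mathfrak g^0$ is the sheaf of stabilisers of points of $Z$, i.e. of expansions at $0$ of vertical vector fields on $E$. It carries the connection induced by the action $\xi\mapsto\alpha(\xi)+\xi$ of $\mathrm{Der}\,\mathcal K$ on $V$-valued functions on $Z$: $\nabla_{\partial_\tau}[F]=[\alpha(\xi)F+\xi\cdot F]$ for any local $\xi$ such that $\alpha(\xi)$ lifts $\partial_\tau$. A section is flat if it is killed by $\nabla_{\partial_\tau}$. The standard coordinate $t=z$ trivialises $\mathcal V$, so that sections of $\Delta(V)$ are locally represented by holomorphic $V$-valued functions $s(\tau)$. Let $q=e^{2\pi i\tau}$, let $B_{2k}$ be the Bernoulli numbers, and for $k\ge1$ let $$G_{2k}=\frac{(-1)^{k+1}B_{2k}}{(2k)!}(2\pi)^{2k}E_{2k},\qquad E_{2k}=1-\frac{4k}{B_{2k}}\sum_{n\ge1}\frac{n^{2k-1}q^n}{1-q^n},$$ $$-2\pi i\,\bar\zeta(z,\tau)=z^{-1}-\sum_{k\ge1}G_{2k}(\tau)\,z^{2k-1}.$$ **Lemma.** (a) $\bar\zeta$ extends so that $\partial_\tau+\bar\zeta(z,\tau)\partial_z$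 is a well-defined vector field on $E$ (holomorphic away from the zero section, meromorphic along it). (b) Let $V$ be a $(\mathrm{Der}\,\mathcal K,\mathrm{Aut}\,\mathcal O)$-module and let $U\subseteq\mathbb H$ be open. A section of $\Delta(V)$ over $U$ is flat if and only if all its local representatives $s$ satisfy, in $\Delta(V)$, the differential equation $$\frac{\partial s}{\partial\tau}-\bigl(\mathrm{res}_t\,\bar\zeta(t,\tau)L(t)\,dt\bigr)\cdot s=0,$$ that is, $\dfrac{\partial s}{\partial\tau}+\bigl(\bar\zeta(t,\tau)\partial_t\bigr)\cdot s=0$. -/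

import Mathlib

open Filter Topology

noncomputable section

namespace HarishChandra

/-! ### Formal series, the Lie algebra `Der 𝒦` and the group `Aut 𝒪` -/

/-- `𝒪 = ℂ[[z]]`. -/
abbrev FormalO : Type := PowerSeries ℂ

/-- `𝒦 = ℂ((z))`. -/
abbrev FormalK : Type := LaurentSeries ℂ

/-- The formal derivative `d/dz` on `𝒦`. -/
def dz : FormalK →ₗ[ℂ] FormalK := LaurentSeries.derivative ℂ

theorem dz_coeff (f : FormalK) (n : ℤ) : (dz f).coeff n = ((n : ℂ) + 1) * f.coeff (n + 1) := by
  simp [dz]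

theorem dz_single_mul (a : ℤ) (f : FormalK) :
    dz (HahnSeries.single a 1 * f) =
      HahnSeries.single a 1 * dz f + dz (HahnSeries.single a 1) * f := by
  have h1 : dz (HahnSeries.single a (1 : ℂ)) = HahnSeries.single (a - 1) (a : ℂ) := by
    simp [dz]
  rw [h1]
  ext n
  have e1 := HahnSeries.coeff_single_mul_add (r := (1 : ℂ)) (x := f) (a := n + 1 - a) (b := a)
  have e2 := HahnSeries.coeff_single_mul_add (r := (1 : ℂ)) (x := dz f) (a := n - a) (b := a)
  have e3 := HahnSeries.coeff_single_mul_add (r := (a : ℂ)) (x := f) (a := n + 1 - a) (b := a - 1)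
  rw [show n + 1 - a + a = n + 1 by ring] at e1
  rw [show n - a + a = n by ring, dz_coeff, show n - a + 1 = n + 1 - a by ring] at e2
  rw [show n + 1 - a + (a - 1) = n by ring] at e3
  rw [dz_coeff, HahnSeries.coeff_add, e1, e2, e3]
  push_cast
  ring

theorem dz_coe (p : FormalO) :
    dz (HahnSeries.ofPowerSeries ℤ ℂ p) =
      HahnSeries.ofPowerSeries ℤ ℂ (PowerSeries.derivative ℂ p) := by
  ext n
  rw [dz_coeff, PowerSeries.coeff_coe, PowerSeries.coeff_coe]
  rcases lt_trichotomy n (-1) with h | h | h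
  · rw [if_pos (by lia), if_pos (by lia)]; simp
  · subst h; simp
  · obtain ⟨m, rfl⟩ := Int.eq_ofNat_of_zero_le (show 0 ≤ n by lia)
    rw [if_neg (by lia), if_neg (by lia), PowerSeries.coeff_derivative]
    have : ((m : ℤ) + 1).natAbs = m + 1 := by lia
    rw [this]
    simp [mul_comm]

theorem dz_mul (f g : FormalK) : dz (f * g) = f * dz g + dz f * g := by
  rw [← f.single_order_mul_powerSeriesPart, ← g.single_order_mul_powerSeriesPart]
  generalize f.powerSeriesPart = p, g.powerSeriesPart = q, f.order = a, g.order = b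
  have h : dz (HahnSeries.ofPowerSeries ℤ ℂ p * HahnSeries.ofPowerSeries ℤ ℂ q) =
      HahnSeries.ofPowerSeries ℤ ℂ p * dz (HahnSeries.ofPowerSeries ℤ ℂ q) +
      dz (HahnSeries.ofPowerSeries ℤ ℂ p) * HahnSeries.ofPowerSeries ℤ ℂ q := by
    rw [← map_mul, dz_coe, dz_coe, dz_coe, Derivation.leibniz]
    simp only [smul_eq_mul, map_add, map_mul]
    ring
  rw [mul_assoc, dz_single_mul, mul_left_comm, dz_single_mul, h, dz_single_mul, dz_single_mul]
  ring

/-- `Der 𝒦`, the Lie algebra of (continuous) derivations `f(z)∂_z` of `𝒦`. The derivation `f(z)∂_z`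
is recorded by its coefficient `f ∈ 𝒦`. -/
def DerK : Type := LaurentSeries ℂ

instance : AddCommGroup DerK := inferInstanceAs (AddCommGroup (LaurentSeries ℂ))
instance : Module ℂ DerK := inferInstanceAs (Module ℂ (LaurentSeries ℂ))

/-- `vf f` is the derivation `f(z)∂_z`. -/
def vf : FormalK ≃ₗ[ℂ] DerK := LinearEquiv.refl ℂ (LaurentSeries ℂ)

/-- The commutator `[f∂_z, g∂_z] = (f g' - g f')∂_z`. -/
instance : Bracket DerK DerK :=
  ⟨fun D D' => vf (vf.symm D * dz (vf.symm D') - vf.symm D' * dz (vf.symm D))⟩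

theorem bracket_def (D D' : DerK) :
    ⁅D, D'⁆ = vf (vf.symm D * dz (vf.symm D') - vf.symm D' * dz (vf.symm D)) := rfl

instance : LieRing DerK where
  add_lie x y z := by
    simp only [bracket_def, ← map_add]
    congr 1
    simp only [map_add]
    ring
  lie_add x y z := by
    simp only [bracket_def, ← map_add]
    congr 1
    simp only [map_add]
    ring
  lie_self x := by simp [bracket_def]
  leibniz_lie x y z := by
    simp only [bracket_def, ← map_add]
    congr 1
    simp only [LinearEquiv.symm_apply_apply, map_sub, dz_mul]
    ring

instance : LieAlgebra ℂ DerK where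
  lie_smul c x y := by
    simp only [bracket_def, ← map_smul]
    congr 1
    simp only [map_smul]
    simp only [← HahnSeries.C_mul_eq_smul]
    ring

/-- `L_n = -z^{n+1}∂_z`, so that `[L_m, L_n] = (m - n) L_{m+n}`. -/
def L (n : ℤ) : DerK := vf (HahnSeries.single (n + 1) (-1))

/-- `Aut 𝒪`, the group (under composition) of automorphisms `ρ` of the `ℂ`-algebra `ℂ[[z]]`;
`ρ` is determined by `ρ(z) = a₁z + a₂z² + ⋯`, `a₁ ≠ 0`, and `ρ(f) = f ∘ ρ(z)`. -/
abbrev AutO : Type := FormalO ≃ₐ[ℂ] FormalO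

/-- The extension of an automorphism of `𝒪` to its fraction field `𝒦`. -/
def AutO.onK (ρ : AutO) : FormalK ≃+* FormalK :=
  IsFractionRing.ringEquivOfRingEquiv (ρ : FormalO ≃+* FormalO)

/-- The adjoint action `Ad_ρ D = ρ ∘ D ∘ ρ⁻¹` of `Aut 𝒪` on `Der 𝒦`. A derivation of the form
`g(z)∂_z` is determined by its value `g` at `z`, so for `D = f(z)∂_z` the coefficient of `Ad_ρ D`
is `ρ(D(ρ⁻¹(z))) = ρ(f · (ρ⁻¹(z))')`. -/
def Ad (ρ : AutO) (D : DerK) : DerK :=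
  vf (ρ.onK (vf.symm D *
    dz (HahnSeries.ofPowerSeries ℤ ℂ (ρ⁻¹ (PowerSeries.X : FormalO)))))

/-! ### `(Der 𝒦, Aut 𝒪)`-modules -/

/-- Compatibility of an action of the Lie algebra `Der 𝒦` and an action of the group `Aut 𝒪` on a
complex vector space `V` (with the discrete topology), making `V` a `(Der 𝒦, Aut 𝒪)`-module. -/
class IsHCModule (V : Type*) [AddCommGroup V] [Module ℂ V] [LieRingModule DerK V]
    [DistribMulAction AutO V] : Prop where
  /-- The action map `Der 𝒦 ⊗ V → V` is `Aut 𝒪`-equivariant. -/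
  smul_lie : ∀ (ρ : AutO) (D : DerK) (v : V), ρ • ⁅D, v⁆ = ⁅Ad ρ D, ρ • v⁆
  /-- The action of `Der 𝒦` is continuous: each vector is killed by `z^N ℂ[[z]]∂_z` for some `N`. -/
  continuous_lie : ∀ v : V, ∃ N : ℤ, ∀ f : FormalK, (∀ n < N, f.coeff n = 0) → ⁅vf f, v⁆ = 0
  /-- The differential of the action of `Aut 𝒪` is the restriction of the action of `Der 𝒦` to
  `Lie (Aut 𝒪) = zℂ[[z]]∂_z`. The curve `ε ↦ μ ε` in `Aut 𝒪`, given near `0` by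
  `z ↦ z + ε w(z)`, has tangent vector `w(z)∂_z` at `ε = 0`. -/
  hasDerivAt_smul : ∀ w : FormalO, PowerSeries.constantCoeff w = 0 → ∀ μ : ℂ → AutO,
    (∀ᶠ ε in 𝓝 (0 : ℂ), μ ε PowerSeries.X = PowerSeries.X + ε • w) →
    ∀ (v : V) (φ : Module.Dual ℂ V),
      HasDerivAt (fun ε => φ (μ ε • v)) (φ ⁅vf (HahnSeries.ofPowerSeries ℤ ℂ w), v⁆) 0

/-! ### The family `E → ℍ` and its vector fields -/

/-- The upper half plane, as an open subset of `ℂ`. -/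
def upperHalf : Set ℂ := {τ | 0 < τ.im}

/-- The lattice `ℤτ + ℤ`. -/
def lattice (τ : ℂ) : Set ℂ := {z | ∃ m n : ℤ, z = m * τ + n}

/-- The action `(τ, z) ↦ (τ, z + mτ + n)` of `ℤ²` on `ℍ × ℂ`, whose quotient is `E`. -/
def deck (m n : ℤ) (p : ℂ × ℂ) : ℂ × ℂ := (p.1, p.2 + m * p.1 + n)

/-- `a(τ)∂_τ + h(τ, z)∂_z` is a well defined vector field on `E` over the open set `W ⊆ ℍ`:
holomorphic away from the zero section, meromorphic along the zero section, and invariant under the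
action of `ℤ²` on `ℍ × ℂ` (each deck transformation carries it to itself). -/
structure IsVectorField (W : Set ℂ) (a : ℂ → ℂ) (h : ℂ → ℂ → ℂ) : Prop where
  holo_base : DifferentiableOn ℂ a W
  holo_vert : DifferentiableOn ℂ (fun p : ℂ × ℂ => h p.1 p.2) {p | p.1 ∈ W ∧ p.2 ∉ lattice p.1}
  invariant : ∀ τ ∈ W, ∀ z ∉ lattice τ, ∀ m n : ℤ,
    fderiv ℂ (deck m n) (τ, z) (a τ, h τ z) = (a τ, h τ (deck m n (τ, z)).2)
  meromorphic : ∀ τ ∈ W, ∃ (k : ℕ) (g : ℂ × ℂ → ℂ), AnalyticAt ℂ g (τ, 0) ∧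
    ∀ᶠ p in 𝓝 (τ, (0 : ℂ)), p.2 ≠ 0 → p.2 ^ k * h p.1 p.2 = g p

/-- The Laurent series `c ∈ ℂ((z))` is the expansion of `f` at `z = 0`. -/
def Expands (f : ℂ → ℂ) (c : FormalK) : Prop :=
  ∀ᶠ z in 𝓝[≠] (0 : ℂ), HasSum (fun n : ℤ => c.coeff n * z ^ n) (f z)

/-- The expansions at the zero section, in powers of the coordinate `z`, of the vertical components
of the vector fields on `E` minus the zero section, over `W ⊆ ℍ`, that lift `a(τ)∂_τ`.

A formal coordinate at the marked point `0` of `E_τ` is an isomorphism `ρ` from `𝒪` to the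
completed local ring, that is (using `z` to identify the latter with `ℂ[[z]]`) an element `ρ` of
`Aut 𝒪`, the coordinate being `t = ρ(X) ∈ zℂ[[z]]`. Thus the `Aut 𝒪`-bundle of coordinates over `ℍ`
is `Z = ℍ × Aut 𝒪`, with `Aut 𝒪` acting by right multiplication.
The expansion of `h∂_z` in powers of `t` is `Ad_{ρ⁻¹}(h(z)∂_z) ∈ Der 𝒦`, and the action
`α : Der 𝒦 → Θ_Z` given by Virasoro uniformisation sends this element, at the point `(τ, ρ)`, to
the tangent vector to `Z` that moves `τ` with velocity `a(τ)` and leaves `t = ρ(X)`, as a power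
series in `z`, unchanged. In particular for `a = 0` one gets the stabiliser `𝔤⁰` of points of `Z`. -/
def IsLift (W : Set ℂ) (a : ℂ → ℂ) (c : ℂ → FormalK) : Prop :=
  ∃ h : ℂ → ℂ → ℂ, IsVectorField W a h ∧ ∀ τ ∈ W, Expands (h τ) (c τ)

/-! ### Vector-valued holomorphic functions -/

/-- The stalk at `τ` of the sheaf `𝒪_ℂ ⊗ M` of holomorphic functions with values in a complex vector
space `M`, as a subspace of the space of germs of all functions. -/
def holGerm (M : Type*) [AddCommGroup M] [Module ℂ M] (τ : ℂ) : Submodule ℂ (Germ (𝓝 τ) M) :=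
  Submodule.span ℂ {g | ∃ (f : ℂ → ℂ) (e : M), AnalyticAt ℂ f τ ∧ g = ↑(fun x => f x • e)}

open Classical in
/-- The derivative of a function with values in a complex vector space, characterised by applying
all linear functionals (and `0` if there is none). For a holomorphic function
`s = ∑ fᵢ • eᵢ` this is `∑ fᵢ' • eᵢ`. -/
def vderiv {M : Type*} [AddCommGroup M] [Module ℂ M] (s : ℂ → M) (τ : ℂ) : M :=
  if h : ∃ d : M, ∀ φ : Module.Dual ℂ M, HasDerivAt (fun x => φ (s x)) (φ d) τ then h.choose else 0

/-! ### Harish-Chandra localisation on `E → ℍ` -/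

section Localisation

variable (V : Type*) [AddCommGroup V] [Module ℂ V] [LieRingModule DerK V] [LieModule ℂ DerK V]
  [DistribMulAction AutO V] [SMulCommClass AutO ℂ V] [IsHCModule V]

/-- The fibre `Z_τ ×_{Aut 𝒪} V` of the associated bundle, as the space of functions `F : Z_τ → V`
with `F(ρμ) = μ⁻¹F(ρ)`; the class of `(ρ, v)` corresponds to the `F` with `F(ρ) = v`. As
`Z = ℍ × Aut 𝒪`, this is the same vector space for all `τ`, and sections of the associated bundle
are functions of `τ` with values in it. -/
def assocSubmodule : Submodule ℂ (AutO → V) where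
  carrier := {F | ∀ ρ μ : AutO, F (ρ * μ) = μ⁻¹ • F ρ}
  add_mem' hF hG ρ μ := by simp [hF ρ μ, hG ρ μ]
  zero_mem' ρ μ := by simp
  smul_mem' c F hF ρ μ := by simp [hF ρ μ, smul_comm]

/-- The vector space `Z_τ ×_{Aut 𝒪} V`. -/
def Assoc : Type _ := ↥(assocSubmodule V)

instance : AddCommGroup (Assoc V) := inferInstanceAs (AddCommGroup ↥(assocSubmodule V))
instance : Module ℂ (Assoc V) := inferInstanceAs (Module ℂ ↥(assocSubmodule V))

/-- The trivialisation of the associated bundle by the standard coordinate `z` on the curves `E_τ`: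
`v ↦` the class of `(z, v)`. -/
def frame : V →ₗ[ℂ] Assoc V where
  toFun v := (⟨fun ρ => ρ⁻¹ • v, fun ρ μ => by simp [mul_smul]⟩ : ↥(assocSubmodule V))
  map_add' v w := Subtype.ext (funext fun ρ => smul_add ρ⁻¹ v w)
  map_smul' c v := Subtype.ext (funext fun ρ => smul_comm ρ⁻¹ c v)

variable {V} in
/-- The action on the fibre of the associated bundle of the element of
`𝔤_τ = Z_τ ×_{Aut 𝒪} Der 𝒦` given by the class of `(z, D)`, i.e. by `ρ ↦ Ad_{ρ⁻¹} D`. -/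
def act (D : DerK) (F : Assoc V) : Assoc V :=
  (⟨fun ρ => ⁅Ad ρ⁻¹ D, F.1 ρ⁆, fun ρ μ => by
    have key : ∀ σ : AutO, ⁅Ad σ⁻¹ D, F.1 σ⁆ = σ⁻¹ • ⁅D, F.1 1⁆ := fun σ => by
      have h := F.2 1 σ
      rw [one_mul] at h
      rw [h, IsHCModule.smul_lie]
    show ⁅Ad (ρ * μ)⁻¹ D, F.1 (ρ * μ)⁆ = μ⁻¹ • ⁅Ad ρ⁻¹ D, F.1 ρ⁆
    rw [key, key, mul_inv_rev, mul_smul]⟩ : ↥(assocSubmodule V))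

/-- The stalk at `τ` of the subsheaf `𝔤⁰ · 𝒱` of the sheaf `𝒱` of sections of the associated bundle,
where `𝔤⁰` is the sheaf of stabilisers of points of `Z`. -/
def stabGerm (τ : ℂ) : Submodule ℂ (Germ (𝓝 τ) (Assoc V)) :=
  Submodule.span ℂ {g | ∃ (W : Set ℂ) (c : ℂ → FormalK) (F : ℂ → Assoc V),
    IsOpen W ∧ W ⊆ upperHalf ∧ τ ∈ W ∧ IsLift W (fun _ => 0) c ∧
    (F : Germ (𝓝 τ) (Assoc V)) ∈ holGerm (Assoc V) τ ∧ g = ↑(fun x => act (vf (c x)) (F x))}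

/-- The stalk at `τ` of the sheaf of coinvariants `Δ(V) = 𝒱 / 𝔤⁰ · 𝒱`. -/
abbrev DeltaStalk (τ : ℂ) : Type _ :=
  ↥(holGerm (Assoc V) τ) ⧸ (stabGerm V τ).comap (holGerm (Assoc V) τ).subtype

variable {V} in
/-- The class in the stalk of `Δ(V)` at `τ` of a section of the associated bundle near `τ`. -/
def DeltaStalk.mk (τ : ℂ) (F : ℂ → Assoc V)
    (hF : (F : Germ (𝓝 τ) (Assoc V)) ∈ holGerm (Assoc V) τ) : DeltaStalk V τ :=
  Submodule.Quotient.mk ⟨(F : Germ (𝓝 τ) (Assoc V)), hF⟩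

variable {V} in
/-- The connection on `Δ(V)`: `NablaRel τ a b` says that `∇_{∂_τ} a = b` in the stalk at `τ`.
The action of `𝔤 = Der 𝒦` on `V`-valued functions on `Z` is `ξ ↦ α(ξ) + ξ`, so if `a` is the class
of `F`, and the local section `ξ` of `Z ×_{Aut 𝒪} 𝔤` is such that `α(ξ)` is the lift of `∂_τ` to `Z`
leaving the coordinate fixed, then `∇_{∂_τ} a` is the class of `∂_τ F + ξ · F`. -/
def NablaRel (τ : ℂ) (a b : DeltaStalk V τ) : Prop :=
  ∃ (W : Set ℂ) (c : ℂ → FormalK) (F : ℂ → Assoc V)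
    (hF : (F : Germ (𝓝 τ) (Assoc V)) ∈ holGerm (Assoc V) τ)
    (hG : ((fun x => vderiv F x + act (vf (c x)) (F x) : ℂ → Assoc V) :
      Germ (𝓝 τ) (Assoc V)) ∈ holGerm (Assoc V) τ),
    IsOpen W ∧ W ⊆ upperHalf ∧ τ ∈ W ∧ IsLift W (fun _ => 1) c ∧
    a = DeltaStalk.mk τ F hF ∧ b = DeltaStalk.mk τ _ hG

/-- Sections of the sheaf `Δ(V)` over `U ⊆ ℍ`: families of elements of the stalks that are locally
induced by sections of the associated bundle. -/
structure DeltaSection (U : Set ℂ) where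
  /-- The germs of the section. -/
  germ : ∀ τ : U, DeltaStalk V (τ : ℂ)
  locally_lifts : ∀ τ₀ : U, ∃ F : ℂ → Assoc V, ∀ᶠ x in 𝓝 (τ₀ : ℂ), ∀ hx : x ∈ U,
    ∃ hF : (F : Germ (𝓝 x) (Assoc V)) ∈ holGerm (Assoc V) x, germ ⟨x, hx⟩ = DeltaStalk.mk x F hF

variable {V} in
/-- Flat sections of `Δ(V)`: those with `∇_{∂_τ} σ = 0`. -/
def DeltaSection.IsFlat {U : Set ℂ} (σ : DeltaSection V U) : Prop :=
  ∀ τ : U, NablaRel (τ : ℂ) (σ.germ τ) 0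

variable {V} in
/-- `(res_t c(t) L(t) dt) · v` for `c ∈ ℂ((t))`, where `L(t) = ∑ₙ L_n t^{-n-2}`: the coefficient of
`t^{-1}` in `c(t) L(t) v`. Only finitely many terms of the sum are nonzero. -/
def resL (c : FormalK) (v : V) : V := ∑ᶠ n : ℤ, c.coeff (n + 1) • ⁅L n, v⁆

end Localisation

/-! ### Eisenstein series and the function `ζ̄` -/

/-- `E_{2k}(τ) = 1 - (4k / B_{2k}) ∑_{n ≥ 1} n^{2k-1} qⁿ / (1 - qⁿ)`, `q = e^{2πiτ}`, `k ≥ 1`. -/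
def eisE (k : ℕ) (τ : ℂ) : ℂ :=
  1 - 4 * k / ((bernoulli (2 * k) : ℚ) : ℂ) * ∑' n : ℕ,
    ((n : ℂ) + 1) ^ (2 * k - 1) * Complex.exp (2 * Real.pi * Complex.I * τ) ^ (n + 1) /
      (1 - Complex.exp (2 * Real.pi * Complex.I * τ) ^ (n + 1))

/-- `G_{2k} = ((-1)^{k+1} B_{2k} / (2k)!) (2π)^{2k} E_{2k}`, `k ≥ 1`. -/
def eisG (k : ℕ) (τ : ℂ) : ℂ :=
  (-1) ^ (k + 1) * ((bernoulli (2 * k) : ℚ) : ℂ) / ((2 * k).factorial : ℂ) *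
    (2 * Real.pi : ℂ) ^ (2 * k) * eisE k τ

/-- The Laurent series in `t` of `ζ̄(t, τ)`, where
`-2πi ζ̄(t, τ) = t⁻¹ - ∑_{k ≥ 1} G_{2k}(τ) t^{2k-1}`. -/
def zetaBar (τ : ℂ) : FormalK :=
  (-(2 * Real.pi * Complex.I))⁻¹ • (HahnSeries.single (-1) 1 - HahnSeries.ofPowerSeries ℤ ℂ
    (PowerSeries.mk fun j => if Odd j then eisG ((j + 1) / 2) τ else 0))

end HarishChandra

end

open HarishChandra

noncomputable section

namespace HarishChandra

/-! ### Partial derivatives of holomorphic functions of two variables -/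

/-! Part (a). With `q = e^{2πiτ}` and `u = e^{2πiz}`, take `1/2 + u/(1 - u) + ∑ (uⁿ - u⁻ⁿ) qⁿ/(1 -
qⁿ)` on the strip `|Im z| < Im τ`. Where two neighbouring strips overlap, substituting `z + τ` for
`z` increases this function by `1` (`zetaStrip_shift`). It therefore extends to a function `zetaFun`
with `ζ̄(z + mτ + n) = ζ̄(z) + m`, which is exactly the condition for `∂_τ + ζ̄∂_z` to descend to
`E`. The Bernoulli generating function and the Taylor series of the Lambert sum give its expansion
at `z = 0`, which is matched coefficient by coefficient with the Eisenstein series in `zetaBar_eq`.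

Part (b) holds for any family `c` of expansions of a global lift of `∂_τ` (`isFlat_iff`). Put `∇_c =
∂_τ + c∂_z`. The commutator of `∂_τ + h∂_z` with a vertical vector field on `E` is again a vertical
vector field on `E` (`IsVectorField.bracketVert`, `IsLift.bracket`), and `∇_c(d·F) = (d' + [c,d])·F
+ d·∇_c F` (`nabla_lie`). Hence `∇_c` preserves `𝔤⁰·𝒱` (`nabla_mem_stabGerm`). Two lifts of `∂_τ`
differ by a section of `𝔤⁰`, so vanishing of the connection does not depend on the representative or
on the lift (`nablaRel_zero_iff`). In the trivialisation by `z`, with `L_n = -z^{n+1}∂_z`, the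
condition `∇_c F = 0` in the quotient is the stated equation.

The analytic input is that expansions of vector fields have holomorphic coefficients and poles of
locally bounded order. With the smoothness of `V`, this makes `c(τ)·F(τ)` a locally finite
holomorphic sum that satisfies the Leibniz rule. -/

theorem differentiableAt_fderiv_apply {Ω : Set (ℂ × ℂ)} (hΩ : IsOpen Ω) {f : ℂ × ℂ → ℂ}
    (hf : DifferentiableOn ℂ f Ω) {v : ℂ × ℂ} (hv : ‖v‖ ≤ 1) {p₀ : ℂ × ℂ} (hp₀ : p₀ ∈ Ω) :
    DifferentiableAt ℂ (fun p => fderiv ℂ f p v) p₀ := by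
  have hc : ContinuousAt f p₀ := (hf.differentiableAt (hΩ.mem_nhds hp₀)).continuousAt
  -- On this ball `f` varies by less than `2`, so Cauchy's estimate bounds `fderiv ℂ f` uniformly on
  -- the ball of half the radius. This bound is the domination needed to differentiate under the
  -- integral below.
  obtain ⟨R, hR, hball⟩ : ∃ R > 0, ∀ p ∈ Metric.ball p₀ R, p ∈ Ω ∧ dist (f p) (f p₀) < 1 :=
    Metric.eventually_nhds_iff_ball.1
      (Filter.Eventually.and (hΩ.eventually_mem hp₀) (hc.eventually (Metric.ball_mem_nhds _ one_pos)))
  have hsub : ∀ p ∈ Metric.ball p₀ (R / 2), Metric.ball p (R / 2) ⊆ Metric.ball p₀ R :=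
    fun p hp => Metric.ball_subset_ball' (by linarith [Metric.mem_ball.1 hp])
  have hbound : ∀ p ∈ Metric.ball p₀ (R / 2), ‖fderiv ℂ f p‖ ≤ 2 / (R / 2) := fun p hp => by
    refine Complex.norm_fderiv_le_div_of_mapsTo_ball
      (fun x hx => (hf.differentiableAt (hΩ.mem_nhds (hball x (hsub p hp hx)).1)).differentiableWithinAt)
      (fun x hx => ?_) (by positivity)
    have h1 := (hball x (hsub p hp hx)).2
    have h2 := (hball p (hsub p hp (Metric.mem_ball_self (by positivity)))).2
    rw [dist_comm] at h2
    rw [Metric.mem_closedBall]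
    linarith [dist_triangle (f x) (f p₀) (f p)]
  set r : ℝ := R / 8 with hr
  have hr0 : 0 < r := by positivity
  have hmem : ∀ p ∈ Metric.ball p₀ (R / 4), ∀ ξ : ℂ, ‖ξ‖ ≤ r →
      p + ξ • v ∈ Metric.ball p₀ (R / 2) := fun p hp ξ hξ => by
    rw [Metric.mem_ball] at hp ⊢
    have h1 : ‖ξ • v‖ ≤ r := by
      rw [norm_smul]
      calc ‖ξ‖ * ‖v‖ ≤ r * 1 := by gcongr
        _ = r := mul_one r
    have h2 : dist (p + ξ • v) p ≤ r := by simpa [dist_eq_norm] using h1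
    linarith [dist_triangle (p + ξ • v) p p₀]
  have hdiff : ∀ p ∈ Metric.ball p₀ (R / 2), DifferentiableAt ℂ f p := fun p hp =>
    hf.differentiableAt (hΩ.mem_nhds (hball p (Metric.ball_subset_ball (by linarith) hp)).1)
  -- Cauchy's formula for the derivative at `0` of `ξ ↦ f (p + ξ • v)`. Since `‖v‖ ≤ 1`, the circle
  -- of radius `R / 8` stays where `f` is controlled. The right side involves only values of `f`, so
  -- it can be differentiated in `p`.
  have key : ∀ p ∈ Metric.ball p₀ (R / 4), fderiv ℂ f p v =
      (2 * Real.pi * Complex.I : ℂ)⁻¹ • ∫ θ in Set.Ioc 0 (2 * Real.pi),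
        (deriv (circleMap 0 r) θ * ((circleMap 0 r θ - 0) ^ 2)⁻¹) • f (p + circleMap 0 r θ • v) := by
    intro p hp
    have hd : DifferentiableOn ℂ (fun ξ : ℂ => f (p + ξ • v)) (Metric.closedBall 0 r) := by
      intro ξ hξ
      have := hdiff _ (hmem p hp ξ (by simpa using hξ))
      exact (this.comp ξ (by fun_prop : DifferentiableAt ℂ (fun ξ : ℂ => p + ξ • v) ξ)).differentiableWithinAt
    have h1 : deriv (fun ξ : ℂ => f (p + ξ • v)) 0 = fderiv ℂ f p v := by
      have h2 : HasFDerivAt f (fderiv ℂ f p) (p + (0 : ℂ) • v) := by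
        simpa using (hdiff p (Metric.ball_subset_ball (by linarith) hp)).hasFDerivAt
      have h3 : HasDerivAt (fun ξ : ℂ => p + ξ • v) v 0 := by
        simpa using ((hasDerivAt_id (0 : ℂ)).smul_const v).const_add p
      exact (h2.comp_hasDerivAt (0 : ℂ) h3).deriv
    rw [← h1, eq_inv_smul_iff₀ Complex.two_pi_I_ne_zero,
      ← DifferentiableOn.deriv_eq_smul_circleIntegral hr0 hd, circleIntegral,
      intervalIntegral.integral_of_le (by positivity)]
    simp [mul_assoc]
  have hcm : Continuous fun θ : ℝ => circleMap 0 r θ := continuous_circleMap 0 r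
  set w : ℝ → ℂ := fun θ => deriv (circleMap 0 r) θ * ((circleMap 0 r θ - 0) ^ 2)⁻¹ with hw
  have hwc : Continuous w := by
    have : ∀ θ, circleMap 0 r θ ≠ 0 := fun θ => circleMap_ne_center hr0.ne'
    have h2 : Continuous fun θ => deriv (circleMap 0 r) θ := by
      simp only [deriv_circleMap]; fun_prop
    exact h2.mul (((hcm.sub continuous_const).pow 2).inv₀ fun θ => by simpa using this θ)
  have hcont : ∀ p ∈ Metric.ball p₀ (R / 4),
      Continuous fun θ : ℝ => w θ • f (p + circleMap 0 r θ • v) := fun p hp => by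
    refine hwc.smul (continuous_iff_continuousAt.2 fun θ => ?_)
    have h3 : ContinuousAt f (p + circleMap 0 r θ • v) :=
      (hdiff _ (hmem p hp _ (by simp [abs_of_pos hr0]))).continuousAt
    exact ContinuousAt.comp' (f := fun θ => p + circleMap 0 r θ • v) h3 (by fun_prop)
  have hnear : Metric.ball p₀ (R / 4) ∈ 𝓝 p₀ := Metric.ball_mem_nhds _ (by positivity)
  have hp₀' : p₀ ∈ Metric.ball p₀ (R / 4) := Metric.mem_ball_self (by positivity)
  have main := hasFDerivAt_integral_of_dominated_of_fderiv_le (𝕜 := ℂ)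
    (μ := MeasureTheory.volume.restrict (Set.Ioc 0 (2 * Real.pi))) (x₀ := p₀)
    (F := fun p θ => w θ • f (p + circleMap 0 r θ • v))
    (F' := fun p θ => w θ • fderiv ℂ f (p + circleMap 0 r θ • v))
    (bound := fun θ => ‖w θ‖ * (2 / (R / 2))) hnear
    (by
      filter_upwards [hnear] with p hp
      exact (hcont p hp).aestronglyMeasurable)
    ((hcont p₀ hp₀').integrableOn_Ioc)
    (by
      refine (hwc.aestronglyMeasurable).smul ?_
      exact ((measurable_fderiv ℂ f).comp
        (by fun_prop : Continuous fun θ : ℝ => p₀ + circleMap 0 r θ • v).measurable).aestronglyMeasurable)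
    (by
      refine Eventually.of_forall fun θ p hp => ?_
      rw [norm_smul]
      gcongr
      exact hbound _ (hmem p hp _ (by simp [abs_of_pos hr0])))
    ((by fun_prop : Continuous fun θ => ‖w θ‖ * (2 / (R / 2))).integrableOn_Ioc)
    (by
      refine Eventually.of_forall fun θ p hp => ?_
      have h4 := (hdiff _ (hmem p hp (circleMap 0 r θ) (by simp [abs_of_pos hr0]))).hasFDerivAt
      exact (HasFDerivAt.comp p h4 ((hasFDerivAt_id p).add_const _)).const_smul (w θ))
  refine DifferentiableAt.congr_of_eventuallyEq
    (main.differentiableAt.const_smul (2 * Real.pi * Complex.I : ℂ)⁻¹) ?_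
  filter_upwards [hnear] with p hp
  exact key p hp

/-- `∂_τ` of a function of `(τ, z)`. -/
def partialFst (g : ℂ × ℂ → ℂ) (p : ℂ × ℂ) : ℂ := fderiv ℂ g p (1, 0)

/-- `∂_z` of a function of `(τ, z)`. -/
def partialSnd (g : ℂ × ℂ → ℂ) (p : ℂ × ℂ) : ℂ := fderiv ℂ g p (0, 1)

theorem analyticAt_partialFst {g : ℂ × ℂ → ℂ} {p : ℂ × ℂ} (hg : AnalyticAt ℂ g p) :
    AnalyticAt ℂ (partialFst g) p :=
  ((ContinuousLinearMap.apply ℂ ℂ ((1, 0) : ℂ × ℂ)).analyticAt _).comp hg.fderiv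

theorem analyticAt_partialSnd {g : ℂ × ℂ → ℂ} {p : ℂ × ℂ} (hg : AnalyticAt ℂ g p) :
    AnalyticAt ℂ (partialSnd g) p :=
  ((ContinuousLinearMap.apply ℂ ℂ ((0, 1) : ℂ × ℂ)).analyticAt _).comp hg.fderiv

theorem hasDerivAt_fst {g : ℂ × ℂ → ℂ} {x z : ℂ} (hg : DifferentiableAt ℂ g (x, z)) :
    HasDerivAt (fun y => g (y, z)) (partialFst g (x, z)) x :=
  HasFDerivAt.comp_hasDerivAt x hg.hasFDerivAt ((hasDerivAt_id x).prodMk (hasDerivAt_const x z))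

theorem hasDerivAt_snd {g : ℂ × ℂ → ℂ} {x z : ℂ} (hg : DifferentiableAt ℂ g (x, z)) :
    HasDerivAt (fun y => g (x, y)) (partialSnd g (x, z)) z :=
  HasFDerivAt.comp_hasDerivAt z hg.hasFDerivAt ((hasDerivAt_const z x).prodMk (hasDerivAt_id z))

theorem partialFst_partialSnd {g : ℂ × ℂ → ℂ} {p : ℂ × ℂ} (hg : AnalyticAt ℂ g p) :
    partialFst (partialSnd g) p = partialSnd (partialFst g) p := by
  have hs : IsSymmSndFDerivAt ℂ g p := hg.contDiffAt.isSymmSndFDerivAt (n := ⊤) le_top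
  have hd : DifferentiableAt ℂ (fderiv ℂ g) p := hg.fderiv.differentiableAt
  have key : ∀ v w : ℂ × ℂ, fderiv ℂ (fun q => fderiv ℂ g q v) p w =
      fderiv ℂ (fderiv ℂ g) p w v := fun v w => by
    rw [fderiv_clm_apply hd (differentiableAt_const v)]
    simp
  show fderiv ℂ (fun q => fderiv ℂ g q (0, 1)) p (1, 0) =
    fderiv ℂ (fun q => fderiv ℂ g q (1, 0)) p (0, 1)
  rw [key, key, hs]

theorem analyticAt_iterate_partialSnd {g : ℂ × ℂ → ℂ} {p : ℂ × ℂ} (hg : AnalyticAt ℂ g p)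
    (n : ℕ) : AnalyticAt ℂ (partialSnd^[n] g) p := by
  induction n with
  | zero => exact hg
  | succ n ih =>
    rw [Function.iterate_succ_apply']
    exact analyticAt_partialSnd ih

theorem partialSnd_congr {g g' : ℂ × ℂ → ℂ} {p : ℂ × ℂ} (h : g =ᶠ[𝓝 p] g') :
    partialSnd g =ᶠ[𝓝 p] partialSnd g' :=
  h.fderiv.fun_comp fun A => A (0, 1)

theorem iterate_partialSnd_congr {g g' : ℂ × ℂ → ℂ} {p : ℂ × ℂ} (h : g =ᶠ[𝓝 p] g') (n : ℕ) :
    partialSnd^[n] g =ᶠ[𝓝 p] partialSnd^[n] g' := by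
  induction n with
  | zero => exact h
  | succ n ih =>
    rw [Function.iterate_succ_apply', Function.iterate_succ_apply']
    exact partialSnd_congr ih

theorem partialFst_iterate_partialSnd {g : ℂ × ℂ → ℂ} {p : ℂ × ℂ} (hg : AnalyticAt ℂ g p)
    (n : ℕ) : partialFst (partialSnd^[n] g) p = partialSnd^[n] (partialFst g) p := by
  induction n generalizing g with
  | zero => rfl
  | succ n ih =>
    rw [Function.iterate_succ_apply, Function.iterate_succ_apply, ih (analyticAt_partialSnd hg)]
    refine (iterate_partialSnd_congr ?_ n).eq_of_nhds
    filter_upwards [hg.eventually_analyticAt] with q hq using partialFst_partialSnd hq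

theorem iteratedDeriv_eq_iterate_partialSnd {g : ℂ × ℂ → ℂ} {x z : ℂ}
    (hg : AnalyticAt ℂ g (x, z)) (n : ℕ) :
    iteratedDeriv n (fun y => g (x, y)) z = partialSnd^[n] g (x, z) := by
  induction n generalizing g with
  | zero => simp
  | succ n ih =>
    rw [iteratedDeriv_succ', Function.iterate_succ_apply, ← ih (analyticAt_partialSnd hg)]
    refine Filter.EventuallyEq.iteratedDeriv_eq n ?_
    have hc : Tendsto (fun y => (x, y)) (𝓝 z) (𝓝 (x, z)) :=
      (by fun_prop : Continuous fun y : ℂ => (x, y)).tendsto z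
    filter_upwards [hc.eventually hg.eventually_analyticAt] with y hy
    exact (hasDerivAt_snd hy.differentiableAt).deriv

/-- The Taylor series of `g(x, z)` in powers of `z`. -/
def taylorSnd (g : ℂ × ℂ → ℂ) (x : ℂ) : FormalO :=
  PowerSeries.mk fun n => partialSnd^[n] g (x, 0) / (n.factorial : ℂ)

/-- The coefficients are iterated `∂_z`-derivatives at `z = 0`, and `∂_τ` commutes with those. -/
theorem hasDerivAt_coeff_taylorSnd {g : ℂ × ℂ → ℂ} {x : ℂ} (hg : AnalyticAt ℂ g (x, 0)) (n : ℕ) :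
    HasDerivAt (fun y => PowerSeries.coeff n (taylorSnd g y))
      (PowerSeries.coeff n (taylorSnd (partialFst g) x)) x := by
  simp only [taylorSnd, PowerSeries.coeff_mk, ← partialFst_iterate_partialSnd hg n]
  exact (hasDerivAt_fst (analyticAt_iterate_partialSnd hg n).differentiableAt).div_const _

/-! ### Convergent power series and Laurent series -/

/-- The power series `p` converges to `G` near `0`. -/
def ExpandsPS (G : ℂ → ℂ) (p : FormalO) : Prop :=
  ∀ᶠ z in 𝓝 (0 : ℂ), HasSum (fun n : ℕ => PowerSeries.coeff n p * z ^ n) (G z)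

theorem expandsPS_taylor {G : ℂ → ℂ} (hG : AnalyticAt ℂ G 0) :
    ExpandsPS G (PowerSeries.mk fun n => iteratedDeriv n G 0 / (n.factorial : ℂ)) := by
  obtain ⟨r, hr, hball⟩ := Metric.eventually_nhds_iff_ball.1 hG.eventually_analyticAt
  filter_upwards [Metric.ball_mem_nhds (0 : ℂ) hr] with z hz
  have := Complex.hasSum_taylorSeries_on_ball (f := G)
    (fun w hw => (hball w hw).differentiableAt.differentiableWithinAt) hz
  refine this.congr_fun fun n => ?_
  simp only [PowerSeries.coeff_mk, smul_eq_mul, sub_zero]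
  ring

theorem expandsPS_taylorSnd {g : ℂ × ℂ → ℂ} {x : ℂ} (hg : AnalyticAt ℂ g (x, 0)) :
    ExpandsPS (fun z => g (x, z)) (taylorSnd g x) := by
  have h1 : AnalyticAt ℂ (fun z => g (x, z)) 0 :=
    AnalyticAt.fun_comp (f := fun z : ℂ => (x, z)) hg (by fun_prop)
  have := expandsPS_taylor h1
  simpa only [iteratedDeriv_eq_iterate_partialSnd hg, taylorSnd] using this

theorem ExpandsPS.hasFPowerSeriesAt {G : ℂ → ℂ} {p : FormalO} (h : ExpandsPS G p) :
    HasFPowerSeriesAt G (FormalMultilinearSeries.ofScalars ℂ fun n => PowerSeries.coeff n p) 0 := by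
  rw [hasFPowerSeriesAt_iff]
  filter_upwards [h] with z hz
  simpa [FormalMultilinearSeries.coeff_ofScalars, mul_comm] using hz

theorem ExpandsPS.analyticAt {G : ℂ → ℂ} {p : FormalO} (h : ExpandsPS G p) : AnalyticAt ℂ G 0 :=
  h.hasFPowerSeriesAt.analyticAt

theorem ExpandsPS.unique {G : ℂ → ℂ} {p p' : FormalO} (h : ExpandsPS G p)
    (h' : ExpandsPS G p') : p = p' := by
  have := h.hasFPowerSeriesAt.eq_formalMultilinearSeries h'.hasFPowerSeriesAt
  ext n
  simpa [FormalMultilinearSeries.coeff_ofScalars] using congrArg (fun q => q.coeff n) this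

theorem ExpandsPS.congr {G G' : ℂ → ℂ} {p : FormalO} (h : ExpandsPS G p) (hG : G =ᶠ[𝓝 0] G') :
    ExpandsPS G' p := by
  filter_upwards [h, hG] with z hz hz'
  rwa [← hz']

theorem ExpandsPS.deriv {G : ℂ → ℂ} {p : FormalO} (h : ExpandsPS G p) :
    ExpandsPS (deriv G) (PowerSeries.derivative ℂ p) := by
  have h1 := expandsPS_taylor h.analyticAt.deriv
  convert h1 using 1
  ext n
  rw [h.unique (expandsPS_taylor h.analyticAt), PowerSeries.coeff_derivative, PowerSeries.coeff_mk,
    PowerSeries.coeff_mk, iteratedDeriv_succ', Nat.factorial_succ]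
  push_cast
  field_simp

theorem ExpandsPS.mul {G G' : ℂ → ℂ} {p p' : FormalO} (h : ExpandsPS G p)
    (h' : ExpandsPS G' p') : ExpandsPS (fun z => G z * G' z) (p * p') := by
  filter_upwards [h, h'] with z hz hz'
  have hs := hz.summable.norm
  have hs' := hz'.summable.norm
  have h1 := tsum_mul_tsum_eq_tsum_sum_antidiagonal_of_summable_norm hs hs'
  have h2 := (summable_norm_sum_mul_antidiagonal_of_summable_norm hs hs').of_norm
  rw [hz.tsum_eq, hz'.tsum_eq] at h1
  rw [h1]
  refine h2.hasSum.congr_fun fun n => ?_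
  rw [PowerSeries.coeff_mul, Finset.sum_mul]
  refine Finset.sum_congr rfl fun ij hij => ?_
  rw [← Finset.HasAntidiagonal.mem_antidiagonal.1 hij, pow_add]
  ring

/-! ### Laurent series as `z^{-k}` times a power series -/

theorem coeff_single_neg_mul (k : ℕ) (p : FormalO) (n : ℕ) :
    (HahnSeries.single (-(k : ℤ)) 1 * HahnSeries.ofPowerSeries ℤ ℂ p : FormalK).coeff (n - k) =
      PowerSeries.coeff n p := by
  have := HahnSeries.coeff_single_mul_add (r := (1 : ℂ)) (x := HahnSeries.ofPowerSeries ℤ ℂ p)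
    (a := (n : ℤ)) (b := -(k : ℤ))
  rw [← sub_eq_add_neg, one_mul] at this
  rw [this, PowerSeries.coeff_coe, if_neg (by lia)]
  simp

theorem coeff_single_neg_mul_of_lt (k : ℕ) (p : FormalO) {m : ℤ} (hm : m < -k) :
    (HahnSeries.single (-(k : ℤ)) 1 * HahnSeries.ofPowerSeries ℤ ℂ p : FormalK).coeff m = 0 := by
  have := HahnSeries.coeff_single_mul_add (r := (1 : ℂ)) (x := HahnSeries.ofPowerSeries ℤ ℂ p)
    (a := m + k) (b := -(k : ℤ))
  rw [add_neg_cancel_right, one_mul] at this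
  rw [this, PowerSeries.coeff_coe, if_pos (by lia)]

/-- Multiplication by `z^k` turns the sum over `ℤ` into a sum over `ℕ`, so questions about `Expands`
reduce to `ExpandsPS`. -/
theorem hasSum_single_neg_mul_iff (k : ℕ) (p : FormalO) {z : ℂ} (hz : z ≠ 0) (s : ℂ) :
    HasSum (fun n : ℤ => (HahnSeries.single (-(k : ℤ)) 1 * HahnSeries.ofPowerSeries ℤ ℂ p :
      FormalK).coeff n * z ^ n) s ↔
    HasSum (fun n : ℕ => PowerSeries.coeff n p * z ^ n) (z ^ k * s) := by
  have hinj : Function.Injective fun n : ℕ => (n : ℤ) - k := fun a b hab => by simpa using hab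
  rw [← hinj.hasSum_iff]
  · have hk : z ^ k ≠ 0 := pow_ne_zero k hz
    rw [← hasSum_mul_left_iff hk]
    have : ∀ n : ℕ, z ^ k * (PowerSeries.coeff n p * z ^ ((n : ℤ) - k)) =
        PowerSeries.coeff n p * z ^ n := fun n => by
      rw [zpow_sub₀ hz, zpow_natCast, zpow_natCast]
      field_simp
    simp only [Function.comp, coeff_single_neg_mul, this]
  · intro m hm
    rw [coeff_single_neg_mul_of_lt, zero_mul]
    by_contra hlt
    exact hm ⟨(m + k).toNat, by simp only []; lia⟩

theorem exists_eq_single_neg_mul (c : FormalK) :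
    ∃ (k : ℕ) (p : FormalO),
      c = HahnSeries.single (-(k : ℤ)) 1 * HahnSeries.ofPowerSeries ℤ ℂ p := by
  obtain ⟨a, ha⟩ : ∃ a : ℕ, 0 ≤ c.order + a := ⟨(-c.order).toNat, by lia⟩
  obtain ⟨b, hb⟩ := Int.eq_ofNat_of_zero_le ha
  refine ⟨a, PowerSeries.X ^ b * c.powerSeriesPart, ?_⟩
  rw [map_mul, HahnSeries.ofPowerSeries_X_pow, ← mul_assoc, HahnSeries.single_mul_single, mul_one,
    show -(a : ℤ) + b = c.order by lia]
  exact (c.single_order_mul_powerSeriesPart).symm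

theorem ExpandsPS.expands {G : ℂ → ℂ} {p : FormalO} (h : ExpandsPS G p) {f : ℂ → ℂ} {k : ℕ}
    (hf : ∀ᶠ z in 𝓝[≠] (0 : ℂ), z ^ k * f z = G z) :
    Expands f (HahnSeries.single (-(k : ℤ)) 1 * HahnSeries.ofPowerSeries ℤ ℂ p) := by
  filter_upwards [hf, h.filter_mono nhdsWithin_le_nhds, self_mem_nhdsWithin] with z hz hz' h0
  rw [hasSum_single_neg_mul_iff k p h0, hz]
  exact hz'

theorem Expands.exists_expandsPS {f : ℂ → ℂ} {c : FormalK} (h : Expands f c) :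
    ∃ (k : ℕ) (p : FormalO) (G : ℂ → ℂ),
      c = HahnSeries.single (-(k : ℤ)) 1 * HahnSeries.ofPowerSeries ℤ ℂ p ∧ ExpandsPS G p ∧
      ∀ᶠ z in 𝓝[≠] (0 : ℂ), z ^ k * f z = G z := by
  obtain ⟨k, p, rfl⟩ := exists_eq_single_neg_mul c
  -- `Expands` says nothing about the value of `f` at `0`, so `G` is given there the value that
  -- makes it analytic.
  refine ⟨k, p, fun z => if z = 0 then PowerSeries.coeff 0 p else z ^ k * f z, rfl, ?_, ?_⟩
  · have h' := eventually_nhdsWithin_iff.1 h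
    filter_upwards [h'] with z hz
    by_cases h0 : z = 0
    · subst h0
      rw [if_pos rfl]
      convert hasSum_single 0 fun n hn => ?_ using 1
      · simp
      · simp [hn]
    · rw [if_neg h0, ← hasSum_single_neg_mul_iff k p h0]
      exact hz h0
  · filter_upwards [self_mem_nhdsWithin] with z hz
    rw [if_neg (show z ≠ 0 from hz)]

theorem Expands.congr {f f' : ℂ → ℂ} {c : FormalK} (h : Expands f c) (hf : f =ᶠ[𝓝[≠] 0] f') :
    Expands f' c := by
  filter_upwards [h, hf] with z hz hz'
  rwa [← hz']

theorem Expands.add {f f' : ℂ → ℂ} {c c' : FormalK} (h : Expands f c) (h' : Expands f' c') :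
    Expands (fun z => f z + f' z) (c + c') := by
  filter_upwards [h, h'] with z hz hz'
  simpa [add_mul] using hz.add hz'

theorem Expands.sub {f f' : ℂ → ℂ} {c c' : FormalK} (h : Expands f c) (h' : Expands f' c') :
    Expands (fun z => f z - f' z) (c - c') := by
  filter_upwards [h, h'] with z hz hz'
  simpa [sub_mul] using hz.sub hz'

theorem Expands.eq_zero {c : FormalK} (h : Expands (fun _ => 0) c) : c = 0 := by
  obtain ⟨k, p, G, rfl, hp, hG⟩ := h.exists_expandsPS
  simp only [mul_zero] at hG
  have h0 : (fun _ => (0 : ℂ)) =ᶠ[𝓝 0] G :=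
    (ContinuousAt.eventuallyEq_nhds_iff_eventuallyEq_nhdsNE continuousAt_const
      hp.analyticAt.continuousAt).1 hG
  have hz : ExpandsPS (fun _ => 0) (0 : FormalO) :=
    Eventually.of_forall fun z => by simp
  rw [hp.unique (hz.congr h0)]
  simp

theorem Expands.unique {f : ℂ → ℂ} {c c' : FormalK} (h : Expands f c) (h' : Expands f c') :
    c = c' := by
  have := h.sub h'
  simp only [sub_self] at this
  exact sub_eq_zero.1 this.eq_zero

theorem Expands.mul {f f' : ℂ → ℂ} {c c' : FormalK} (h : Expands f c) (h' : Expands f' c') :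
    Expands (fun z => f z * f' z) (c * c') := by
  obtain ⟨k, p, G, rfl, hp, hG⟩ := h.exists_expandsPS
  obtain ⟨k', p', G', rfl, hp', hG'⟩ := h'.exists_expandsPS
  rw [mul_mul_mul_comm, HahnSeries.single_mul_single, ← map_mul, mul_one,
    show -(k : ℤ) + -(k' : ℤ) = -((k + k' : ℕ) : ℤ) by push_cast; ring]
  refine (hp.mul hp').expands ?_
  filter_upwards [hG, hG'] with z hz hz'
  rw [← hz, ← hz']
  ring

theorem ExpandsPS.expands_coe {G : ℂ → ℂ} {p : FormalO} (h : ExpandsPS G p) :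
    Expands G (HahnSeries.ofPowerSeries ℤ ℂ p) := by
  have := h.expands (k := 0) (f := G) (by simp)
  simpa using this

theorem expands_zpow (a : ℤ) : Expands (fun z => z ^ a) (HahnSeries.single a 1) := by
  refine Eventually.of_forall fun z => ?_
  convert hasSum_single a fun n hn => ?_ using 1
  · simp
  · simp [HahnSeries.coeff_single_of_ne hn]

theorem dz_single (a : ℤ) :
    dz (HahnSeries.single a 1) = HahnSeries.C (a : ℂ) * HahnSeries.single (a - 1) 1 := by
  rw [HahnSeries.C_mul_eq_smul]
  ext n
  simp [dz, HahnSeries.coeff_single]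

theorem expands_const (a : ℂ) : Expands (fun _ => a) (HahnSeries.C a) := by
  refine Eventually.of_forall fun z => ?_
  convert hasSum_single (0 : ℤ) fun n hn => ?_ using 1
  · simp
  · simp [HahnSeries.C_apply, HahnSeries.coeff_single_of_ne hn]

theorem Expands.deriv {f : ℂ → ℂ} {c : FormalK} (h : Expands f c) : Expands (deriv f) (dz c) := by
  obtain ⟨k, p, G, rfl, hp, hG⟩ := h.exists_expandsPS
  rw [dz_mul, dz_coe, dz_single]
  have h1 := ((expands_zpow (-k)).mul hp.deriv.expands_coe).add
    (((expands_const ((-(k : ℤ) : ℤ) : ℂ)).mul (expands_zpow (-(k : ℤ) - 1))).mul hp.expands_coe)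
  refine h1.congr ?_
  rw [Filter.EventuallyEq, eventually_nhdsWithin_iff]
  have hG' := (eventually_nhdsWithin_iff.1 hG).eventually_nhds
  filter_upwards [hG', hp.analyticAt.eventually_analyticAt] with z hz hGz h0
  have hz0 : z ≠ 0 := h0
  have hloc : f =ᶠ[𝓝 z] fun w => w ^ (-(k : ℤ)) * G w := by
    filter_upwards [hz, isOpen_ne.mem_nhds hz0] with w hw hw0
    rw [← hw hw0, ← mul_assoc, zpow_neg, zpow_natCast, inv_mul_cancel₀ (pow_ne_zero _ hw0), one_mul]
  rw [hloc.deriv_eq]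
  have := (hasDerivAt_zpow (-(k : ℤ)) z (Or.inl hz0)).mul hGz.differentiableAt.hasDerivAt
  rw [show (fun w => w ^ (-(k : ℤ)) * G w) = (fun w => w ^ (-(k : ℤ))) * G from rfl, this.deriv]
  ring

/-! ### Vector fields on the family of curves -/

theorem isOpen_upperHalf : IsOpen upperHalf := isOpen_lt continuous_const Complex.continuous_im

/-- The two real numbers are the coordinates of `z` in the real basis `(τ, 1)`. They depend
continuously on `(τ, z)`, so openness of the complement of the lattice follows from closedness of
`ℤ` in `ℝ`. -/
theorem mem_lattice_iff {τ : ℂ} (hτ : τ ∈ upperHalf) (z : ℂ) :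
    z ∈ lattice τ ↔ z.im / τ.im ∈ Set.range ((↑) : ℤ → ℝ) ∧
      z.re - z.im / τ.im * τ.re ∈ Set.range ((↑) : ℤ → ℝ) := by
  have hne : τ.im ≠ 0 := ne_of_gt hτ
  constructor
  · rintro ⟨m, n, rfl⟩
    have h1 : ((m : ℂ) * τ + n).im / τ.im = m := by simp [hne]
    exact ⟨⟨m, h1.symm⟩, ⟨n, by rw [h1]; simp⟩⟩
  · rintro ⟨⟨m, hm⟩, ⟨n, hn⟩⟩
    refine ⟨m, n, Complex.ext ?_ ?_⟩
    · rw [← hm] at hn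
      simp only [Complex.add_re, Complex.mul_re, Complex.intCast_re, Complex.intCast_im, zero_mul,
        sub_zero]
      linarith
    · rw [eq_div_iff hne] at hm
      simp [hm]

theorem isOpen_complement_lattice {W : Set ℂ} (hW : IsOpen W) (hWU : W ⊆ upperHalf) :
    IsOpen {p : ℂ × ℂ | p.1 ∈ W ∧ p.2 ∉ lattice p.1} := by
  have hZ : IsClosed (Set.range ((↑) : ℤ → ℝ)) := Int.isClosedEmbedding_coe_real.isClosed_range
  have hW' : IsOpen {p : ℂ × ℂ | p.1 ∈ W} := hW.preimage continuous_fst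
  have hne : ∀ p ∈ {p : ℂ × ℂ | p.1 ∈ W}, p.1.im ≠ 0 := fun p hp => ne_of_gt (hWU hp)
  have h1 : ContinuousOn (fun p : ℂ × ℂ => p.2.im / p.1.im) {p | p.1 ∈ W} :=
    ContinuousOn.div (by fun_prop) (by fun_prop) hne
  have h2 : ContinuousOn (fun p : ℂ × ℂ => p.2.re - p.2.im / p.1.im * p.1.re) {p | p.1 ∈ W} :=
    ContinuousOn.sub (by fun_prop) (h1.mul (by fun_prop))
  convert (h1.isOpen_inter_preimage hW' hZ.isOpen_compl).union
    (h2.isOpen_inter_preimage hW' hZ.isOpen_compl) using 1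
  ext p
  simp only [Set.mem_ofPred_eq, Set.mem_union, Set.mem_inter_iff, Set.mem_preimage,
    Set.mem_compl_iff]
  by_cases hp : p.1 ∈ W
  · rw [mem_lattice_iff (hWU hp)]
    tauto
  · simp [hp]

theorem add_mem_lattice_iff {τ z : ℂ} (m n : ℤ) : z + m * τ + n ∈ lattice τ ↔ z ∈ lattice τ := by
  constructor
  · rintro ⟨a, b, h⟩
    exact ⟨a - m, b - n, by push_cast; linear_combination h⟩
  · rintro ⟨a, b, rfl⟩
    exact ⟨a + m, b + n, by push_cast; ring⟩

theorem hasFDerivAt_deck (m n : ℤ) (p : ℂ × ℂ) :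
    HasFDerivAt (deck m n) ((ContinuousLinearMap.fst ℂ ℂ ℂ).prod
      (ContinuousLinearMap.snd ℂ ℂ ℂ + (m : ℂ) • ContinuousLinearMap.fst ℂ ℂ ℂ)) p :=
  hasFDerivAt_fst.prodMk ((hasFDerivAt_snd.add (hasFDerivAt_fst.const_mul (m : ℂ))).add_const _)

theorem fderiv_deck_apply (m n : ℤ) (p v : ℂ × ℂ) :
    fderiv ℂ (deck m n) p v = (v.1, v.2 + m * v.1) := by
  rw [(hasFDerivAt_deck m n p).fderiv]
  simp

/-- The differential of a deck transformation sends `∂_τ` to `∂_τ + m∂_z`. Invariance is therefore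
quasi-periodicity of the vertical component, and plain periodicity for a vertical field. -/
theorem IsVectorField.apply_add {W : Set ℂ} {a : ℂ → ℂ} {h : ℂ → ℂ → ℂ} (hv : IsVectorField W a h)
    {τ z : ℂ} (hτ : τ ∈ W) (hz : z ∉ lattice τ) (m n : ℤ) :
    h τ (z + m * τ + n) = h τ z + m * a τ := by
  have := congrArg Prod.snd (hv.invariant τ hτ z hz m n)
  rw [fderiv_deck_apply] at this
  exact this.symm

theorem IsVectorField.mono {W W' : Set ℂ} {a : ℂ → ℂ} {h : ℂ → ℂ → ℂ} (hv : IsVectorField W a h)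
    (hW : W' ⊆ W) : IsVectorField W' a h where
  holo_base := hv.holo_base.mono hW
  holo_vert := hv.holo_vert.mono fun _ hp => ⟨hW hp.1, hp.2⟩
  invariant τ hτ := hv.invariant τ (hW hτ)
  meromorphic τ hτ := hv.meromorphic τ (hW hτ)

theorem IsLift.mono {W W' : Set ℂ} {a : ℂ → ℂ} {c : ℂ → FormalK} (hc : IsLift W a c)
    (hW : W' ⊆ W) : IsLift W' a c := by
  obtain ⟨h, hv, hx⟩ := hc
  exact ⟨h, hv.mono hW, fun τ hτ => hx τ (hW hτ)⟩

theorem IsVectorField.sub {W : Set ℂ} {a a' : ℂ → ℂ} {h h' : ℂ → ℂ → ℂ}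
    (hv : IsVectorField W a h) (hv' : IsVectorField W a' h') :
    IsVectorField W (fun τ => a τ - a' τ) (fun τ z => h τ z - h' τ z) where
  holo_base := hv.holo_base.sub hv'.holo_base
  holo_vert := hv.holo_vert.sub hv'.holo_vert
  invariant τ hτ z hz m n := by
    rw [fderiv_deck_apply]
    simp only [deck]
    rw [hv.apply_add hτ hz, hv'.apply_add hτ hz]
    simp only [Prod.mk.injEq, true_and]
    ring
  meromorphic τ hτ := by
    obtain ⟨k, g, hg, hk⟩ := hv.meromorphic τ hτ
    obtain ⟨k', g', hg', hk'⟩ := hv'.meromorphic τ hτ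
    refine ⟨k + k', fun p => p.2 ^ k' * g p - p.2 ^ k * g' p,
      ((analyticAt_snd.pow k').mul hg).sub ((analyticAt_snd.pow k).mul hg'), ?_⟩
    filter_upwards [hk, hk'] with p hp hp' h0
    rw [← hp h0, ← hp' h0]
    ring

theorem IsLift.sub {W : Set ℂ} {a a' : ℂ → ℂ} {c c' : ℂ → FormalK} (hc : IsLift W a c)
    (hc' : IsLift W a' c') : IsLift W (fun τ => a τ - a' τ) (fun τ => c τ - c' τ) := by
  obtain ⟨h, hv, hx⟩ := hc
  obtain ⟨h', hv', hx'⟩ := hc'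
  exact ⟨_, hv.sub hv', fun τ hτ => (hx τ hτ).sub (hx' τ hτ)⟩

/-! ### Differentiation near the pole and commutators with vertical fields -/

theorem eventually_mul_eq {f g : ℂ × ℂ → ℂ} {k : ℕ} {p₀ : ℂ × ℂ}
    (h : ∀ᶠ p in 𝓝 p₀, p.2 ≠ 0 → p.2 ^ k * f p = g p) :
    ∀ᶠ p in 𝓝 p₀, p.2 ≠ 0 → ∀ᶠ q in 𝓝 p, q.2 ^ k * f q = g q := by
  filter_upwards [h.eventually_nhds] with p hp h0
  filter_upwards [hp, (isOpen_ne.preimage continuous_snd).mem_nhds h0] with q hq hq0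
  exact hq hq0

/-- Differentiate `z^k f = g`. The derivative in `τ` keeps the pole order, while the derivative in
`z` raises it by one. -/
theorem partials_of_mul_eq {f g : ℂ × ℂ → ℂ} {k : ℕ} {p : ℂ × ℂ} (h0 : p.2 ≠ 0)
    (h : ∀ᶠ q in 𝓝 p, q.2 ^ k * f q = g q) (hg : DifferentiableAt ℂ g p) :
    p.2 ^ k * partialFst f p = partialFst g p ∧
      p.2 ^ (k + 1) * partialSnd f p = p.2 * partialSnd g p - k * g p := by
  have hf : f =ᶠ[𝓝 p] fun q => (q.2 ^ k)⁻¹ * g q := by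
    filter_upwards [h, (isOpen_ne.preimage continuous_snd).mem_nhds h0] with q hq hq0
    rw [← hq, inv_mul_cancel_left₀ (pow_ne_zero k hq0)]
  have hp0 : p.2 ^ k ≠ 0 := pow_ne_zero k h0
  have hfd : DifferentiableAt ℂ f p := by
    refine DifferentiableAt.congr_of_eventuallyEq ?_ hf
    exact ((differentiableAt_snd.pow k).inv hp0).mul hg
  have hA := hfd.hasFDerivAt
  have h1 := ((hasFDerivAt_snd (𝕜 := ℂ) (p := p)).pow k).mul hA
  have h2 : fderiv ℂ g p = _ := ((h1.congr_of_eventuallyEq (h.mono fun q hq => hq.symm)).fderiv)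
  have hgp := h.self_of_nhds
  constructor
  · simp only [partialFst, h2]
    simp
  · simp only [partialSnd, h2, ← hgp]
    rcases k with _ | k
    · simp
    · simp
      ring

/-- Chain rule: `∂_τ` of `f(τ, z + mτ + n)` also picks up `m ∂_z f`. -/
theorem partials_deck {f : ℂ × ℂ → ℂ} {p : ℂ × ℂ} {m n : ℤ} {a : ℂ}
    (hf : DifferentiableAt ℂ f (deck m n p))
    (h : ∀ᶠ q in 𝓝 p, f (deck m n q) = f q + a) :
    partialSnd f (deck m n p) = partialSnd f p ∧
      partialFst f (deck m n p) = partialFst f p - m * partialSnd f p := by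
  have h1 := (hf.hasFDerivAt.comp p (hasFDerivAt_deck m n p)).add_const (-a)
  have h2 : fderiv ℂ f p = _ :=
    (h1.congr_of_eventuallyEq (h.mono fun q hq => by simp [hq])).fderiv
  have hv : ((1 : ℂ), (m : ℂ)) = (1, 0) + (m : ℂ) • ((0 : ℂ), (1 : ℂ)) := by simp
  have hs : partialSnd f p = partialSnd f (deck m n p) := by
    simp [partialSnd, h2]
  refine ⟨hs.symm, ?_⟩
  rw [hs]
  have : partialFst f p = fderiv ℂ f (deck m n p) (1, (m : ℂ)) := by
    simp [partialFst, h2]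
  rw [this, hv, map_add, map_smul]
  simp [partialFst, partialSnd]

/-- The vertical component of the commutator `[∂_τ + h∂_z, h'∂_z]`. -/
def bracketVert (h h' : ℂ → ℂ → ℂ) (τ z : ℂ) : ℂ :=
  partialFst (fun p => h' p.1 p.2) (τ, z) + h τ z * partialSnd (fun p => h' p.1 p.2) (τ, z) -
    h' τ z * partialSnd (fun p => h p.1 p.2) (τ, z)

theorem IsVectorField.bracketVert {W : Set ℂ} (hW : IsOpen W) (hWU : W ⊆ upperHalf)
    {h h' : ℂ → ℂ → ℂ} (hv : IsVectorField W (fun _ => 1) h)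
    (hv' : IsVectorField W (fun _ => 0) h') :
    IsVectorField W (fun _ => 0) (bracketVert h h') where
  holo_base := hv'.holo_base
  holo_vert := by
    have hΩ := isOpen_complement_lattice hW hWU
    intro p hp
    have d1 := (hv.holo_vert.differentiableAt (hΩ.mem_nhds hp))
    have d2 := (hv'.holo_vert.differentiableAt (hΩ.mem_nhds hp))
    have e1 : ‖((1, 0) : ℂ × ℂ)‖ ≤ 1 := by simp [Prod.norm_def]
    have e2 : ‖((0, 1) : ℂ × ℂ)‖ ≤ 1 := by simp [Prod.norm_def]
    exact (((differentiableAt_fderiv_apply hΩ hv'.holo_vert e1 hp).add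
      (d1.mul (differentiableAt_fderiv_apply hΩ hv'.holo_vert e2 hp))).sub
      (d2.mul (differentiableAt_fderiv_apply hΩ hv.holo_vert e2 hp))).differentiableWithinAt
  invariant τ hτ z hz m n := by
    have hΩ := isOpen_complement_lattice hW hWU
    have hmem : (τ, z) ∈ {p : ℂ × ℂ | p.1 ∈ W ∧ p.2 ∉ lattice p.1} := ⟨hτ, hz⟩
    have hmem' : deck m n (τ, z) ∈ {p : ℂ × ℂ | p.1 ∈ W ∧ p.2 ∉ lattice p.1} :=
      ⟨hτ, fun hz' => hz ((add_mem_lattice_iff m n).1 hz')⟩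
    -- `h` has quasi-period `m` and `h'` is periodic. Under the deck transformation `∂_τ h'` loses
    -- `m ∂_z h'`, and the shift of `h` by `m` in the term `h ∂_z h'` restores it.
    have p1 := partials_deck (m := m) (n := n) (a := m) (p := (τ, z))
      (hv.holo_vert.differentiableAt (hΩ.mem_nhds hmem'))
      (by filter_upwards [hΩ.mem_nhds hmem] with q hq
          simpa [deck] using hv.apply_add hq.1 hq.2 m n)
    have p2 := partials_deck (m := m) (n := n) (a := 0) (p := (τ, z))
      (hv'.holo_vert.differentiableAt (hΩ.mem_nhds hmem'))
      (by filter_upwards [hΩ.mem_nhds hmem] with q hq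
          simpa [deck] using hv'.apply_add hq.1 hq.2 m n)
    rw [fderiv_deck_apply]
    simp only [mul_zero, add_zero, Prod.mk.injEq, true_and]
    have q1 := hv.apply_add hτ hz m n
    have q2 := hv'.apply_add hτ hz m n
    simp only [HarishChandra.bracketVert]
    change _ = partialFst (fun p => h' p.1 p.2) (deck m n (τ, z)) +
      h τ (z + m * τ + n) * partialSnd (fun p => h' p.1 p.2) (deck m n (τ, z)) -
      h' τ (z + m * τ + n) * partialSnd (fun p => h p.1 p.2) (deck m n (τ, z))
    rw [p1.1, p2.1, p2.2, q1, q2]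
    ring
  meromorphic τ hτ := by
    obtain ⟨k, g, hg, hk⟩ := hv.meromorphic τ hτ
    obtain ⟨k', g', hg', hk'⟩ := hv'.meromorphic τ hτ
    -- The products have pole order at most `k + k'`, and one `∂_z` adds one more.
    refine ⟨k + k' + 1, fun p => p.2 ^ (k + 1) * partialFst g' p +
      g p * (p.2 * partialSnd g' p - k' * g' p) - g' p * (p.2 * partialSnd g p - k * g p), ?_, ?_⟩
    · exact (((analyticAt_snd.pow (k + 1)).mul (analyticAt_partialFst hg')).add
        (hg.mul ((analyticAt_snd.mul (analyticAt_partialSnd hg')).sub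
          (analyticAt_const.mul hg')))).sub
        (hg'.mul ((analyticAt_snd.mul (analyticAt_partialSnd hg)).sub (analyticAt_const.mul hg)))
    · filter_upwards [eventually_mul_eq (f := fun p => h p.1 p.2) hk,
        eventually_mul_eq (f := fun p => h' p.1 p.2) hk', hg.eventually_analyticAt,
        hg'.eventually_analyticAt] with p hp hp' hgp hgp' h0
      obtain ⟨-, s⟩ := partials_of_mul_eq h0 (hp h0) hgp.differentiableAt
      obtain ⟨f', s'⟩ := partials_of_mul_eq h0 (hp' h0) hgp'.differentiableAt
      rw [← s, ← s', ← f', ← (hp h0).self_of_nhds, ← (hp' h0).self_of_nhds]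
      simp only [HarishChandra.bracketVert]
      ring

/-- `c'` is the derivative of the family `c` of Laurent series, whose coefficients are
differentiable and whose polar parts have locally bounded order. -/
def HasSeriesDeriv (W : Set ℂ) (c c' : ℂ → FormalK) : Prop :=
  ∀ τ ∈ W, ∃ k : ℕ, ∀ᶠ x in 𝓝 τ,
    (∀ n : ℤ, n < -k → (c x).coeff n = 0 ∧ (c' x).coeff n = 0) ∧
    ∀ n : ℤ, HasDerivAt (fun y => (c y).coeff n) ((c' x).coeff n) x

theorem tendsto_prodMk_zero (x : ℂ) : Tendsto (fun z : ℂ => (x, z)) (𝓝[≠] 0) (𝓝 (x, 0)) :=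
  ((by fun_prop : Continuous fun z : ℂ => (x, z)).tendsto 0).mono_left nhdsWithin_le_nhds

/-- Near a point of `W`, one `k` makes `g = z^k h` analytic in both variables. By uniqueness of
expansions `c` is `z^{-k}` times the Taylor series of `g`, and its derivative is `z^{-k}` times that
of `∂_τ g`. -/
theorem IsVectorField.exists_hasSeriesDeriv {W : Set ℂ} (hW : IsOpen W) {a : ℂ → ℂ}
    {h : ℂ → ℂ → ℂ} (hv : IsVectorField W a h) {c : ℂ → FormalK}
    (hc : ∀ τ ∈ W, Expands (h τ) (c τ)) :
    ∃ c' : ℂ → FormalK, HasSeriesDeriv W c c' ∧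
      ∀ τ ∈ W, Expands (fun z => partialFst (fun p => h p.1 p.2) (τ, z)) (c' τ) := by
  have key : ∀ τ ∈ W, ∃ (k : ℕ) (g : ℂ × ℂ → ℂ), ∀ᶠ x in 𝓝 τ, x ∈ W ∧ AnalyticAt ℂ g (x, 0) ∧
      c x = HahnSeries.single (-(k : ℤ)) 1 * HahnSeries.ofPowerSeries ℤ ℂ (taylorSnd g x) ∧
      Expands (fun z => partialFst (fun p => h p.1 p.2) (x, z))
        (HahnSeries.single (-(k : ℤ)) 1 *
          HahnSeries.ofPowerSeries ℤ ℂ (taylorSnd (partialFst g) x)) := by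
    intro τ hτ
    obtain ⟨k, g, hg, hk⟩ := hv.meromorphic τ hτ
    refine ⟨k, g, ?_⟩
    have ht : Tendsto (fun x : ℂ => (x, (0 : ℂ))) (𝓝 τ) (𝓝 (τ, 0)) :=
      (by fun_prop : Continuous fun x : ℂ => (x, (0 : ℂ))).tendsto τ
    filter_upwards [hW.mem_nhds hτ, ht.eventually hg.eventually_analyticAt,
      ht.eventually hk.eventually_nhds] with x hxW hgx hkx
    refine ⟨hxW, hgx, (hc x hxW).unique ((expandsPS_taylorSnd hgx).expands ?_),
      (expandsPS_taylorSnd (analyticAt_partialFst hgx)).expands ?_⟩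
    · filter_upwards [(tendsto_prodMk_zero x).eventually hkx, self_mem_nhdsWithin] with z hz h0
      exact hz h0
    · filter_upwards [(tendsto_prodMk_zero x).eventually
        (eventually_mul_eq (f := fun p => h p.1 p.2) hkx),
        (tendsto_prodMk_zero x).eventually hgx.eventually_analyticAt, self_mem_nhdsWithin]
        with z hz hgz h0
      exact (partials_of_mul_eq (p := (x, z)) h0 (hz h0) hgz.differentiableAt).1
  have hex : ∀ τ, ∃ d : FormalK, τ ∈ W →
      Expands (fun z => partialFst (fun p => h p.1 p.2) (τ, z)) d := fun τ => by
    by_cases hτ : τ ∈ W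
    · obtain ⟨_, _, hg⟩ := key τ hτ
      exact ⟨_, fun _ => hg.self_of_nhds.2.2.2⟩
    · exact ⟨0, fun h' => absurd h' hτ⟩
  choose c' hc' using hex
  refine ⟨c', fun τ hτ => ?_, hc'⟩
  obtain ⟨k, g, hg⟩ := key τ hτ
  refine ⟨k, ?_⟩
  filter_upwards [hg, hg.eventually_nhds] with x hx hx'
  obtain ⟨hxW, hgx, hcx, hex⟩ := hx
  have hc'x := (hc' x hxW).unique hex
  have hlt : ∀ n : ℤ, n < -k → ∀ᶠ y in 𝓝 x, (c y).coeff n = 0 := fun n hn => by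
    filter_upwards [hx'] with y hy
    rw [hy.2.2.1, coeff_single_neg_mul_of_lt k _ hn]
  refine ⟨fun n hn => ⟨(hlt n hn).self_of_nhds,
    by rw [hc'x, coeff_single_neg_mul_of_lt k _ hn]⟩, fun n => ?_⟩
  by_cases hn : n < -k
  · rw [hc'x, coeff_single_neg_mul_of_lt k _ hn]
    exact (hasDerivAt_const x (0 : ℂ)).congr_of_eventuallyEq (hlt n hn)
  · obtain ⟨j, rfl⟩ : ∃ j : ℕ, n = j - k := ⟨(n + k).toNat, by lia⟩
    rw [hc'x, coeff_single_neg_mul]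
    refine (hasDerivAt_coeff_taylorSnd hgx j).congr_of_eventuallyEq ?_
    filter_upwards [hx'] with y hy
    rw [hy.2.2.1, coeff_single_neg_mul]

theorem IsLift.exists_hasSeriesDeriv {W : Set ℂ} (hW : IsOpen W) {a : ℂ → ℂ} {c : ℂ → FormalK}
    (hc : IsLift W a c) : ∃ c' : ℂ → FormalK, HasSeriesDeriv W c c' := by
  obtain ⟨h, hv, hx⟩ := hc
  obtain ⟨c', hc', -⟩ := hv.exists_hasSeriesDeriv hW hx
  exact ⟨c', hc'⟩

/-- The new family is the expansion of `[∂_τ + h∂_z, h'∂_z]`, which is again a vertical vector field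
on `E`. This geometric fact is what makes the connection descend to the coinvariants. -/
theorem IsLift.bracket {W : Set ℂ} (hW : IsOpen W) (hWU : W ⊆ upperHalf) {c d : ℂ → FormalK}
    (hc : IsLift W (fun _ => 1) c) (hd : IsLift W (fun _ => 0) d) :
    ∃ d' : ℂ → FormalK, HasSeriesDeriv W d d' ∧
      IsLift W (fun _ => 0) (fun τ => d' τ + (c τ * dz (d τ) - d τ * dz (c τ))) := by
  obtain ⟨h, hv, hx⟩ := hc
  obtain ⟨h', hv', hx'⟩ := hd
  obtain ⟨d', hd', hxd⟩ := hv'.exists_hasSeriesDeriv hW hx'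
  refine ⟨d', hd', _, hv.bracketVert hW hWU hv', fun τ hτ => ?_⟩
  -- The one-variable derivative equals the partial derivative wherever the function is jointly
  -- differentiable, that is, near the zero section but off it.
  have hS : ∀ f : ℂ → ℂ → ℂ, ∀ b, IsVectorField W b f →
      deriv (f τ) =ᶠ[𝓝[≠] 0] fun z => partialSnd (fun p => f p.1 p.2) (τ, z) := by
    intro f b hf
    obtain ⟨k, g, hg, hk⟩ := hf.meromorphic τ hτ
    filter_upwards [(tendsto_prodMk_zero τ).eventually
      (eventually_mul_eq (f := fun p => f p.1 p.2) hk),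
      (tendsto_prodMk_zero τ).eventually hg.eventually_analyticAt, self_mem_nhdsWithin]
      with z hz hgz h0
    have h0' : z ≠ 0 := h0
    have hfd : DifferentiableAt ℂ (fun p : ℂ × ℂ => f p.1 p.2) (τ, z) := by
      have : (fun p : ℂ × ℂ => f p.1 p.2) =ᶠ[𝓝 (τ, z)] fun q => (q.2 ^ k)⁻¹ * g q := by
        filter_upwards [hz h0, (isOpen_ne.preimage continuous_snd).mem_nhds h0'] with q hq hq0
        rw [← hq, inv_mul_cancel_left₀ (pow_ne_zero k hq0)]
      exact DifferentiableAt.congr_of_eventuallyEq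
        (((differentiableAt_snd.pow k).inv (pow_ne_zero k h0')).mul hgz.differentiableAt) this
    exact (hasDerivAt_snd hfd).deriv
  have e := ((hxd τ hτ).add ((hx τ hτ).mul ((hx' τ hτ).deriv.congr (hS _ _ hv')))).sub
    ((hx' τ hτ).mul ((hx τ hτ).deriv.congr (hS _ _ hv)))
  rw [add_sub_assoc] at e
  exact e

/-! ### Derivatives of vector-valued holomorphic functions -/

section VectorValued

variable {M : Type*} [AddCommGroup M] [Module ℂ M]

/-- `d` is the derivative of `s` at `x`, tested against linear functionals. -/
def HasVDerivAt (s : ℂ → M) (d : M) (x : ℂ) : Prop :=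
  ∀ φ : Module.Dual ℂ M, HasDerivAt (fun y => φ (s y)) (φ d) x

/-- Linear functionals separate points of a vector space, so the derivative is unique. -/
theorem HasVDerivAt.vderiv_eq {s : ℂ → M} {d : M} {x : ℂ} (h : HasVDerivAt s d x) :
    vderiv s x = d := by
  have hex : ∃ d : M, ∀ φ : Module.Dual ℂ M, HasDerivAt (fun x => φ (s x)) (φ d) x := ⟨d, h⟩
  rw [vderiv, dif_pos hex, ← sub_eq_zero, ← Module.forall_dual_apply_eq_zero_iff ℂ]
  intro φ
  rw [map_sub, (hex.choose_spec φ).unique (h φ), sub_self]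

theorem HasVDerivAt.congr {s s' : ℂ → M} {d : M} {x : ℂ} (h : HasVDerivAt s d x)
    (hs : s' =ᶠ[𝓝 x] s) : HasVDerivAt s' d x := fun φ =>
  (h φ).congr_of_eventuallyEq (hs.fun_comp φ)

theorem HasVDerivAt.add {s s' : ℂ → M} {d d' : M} {x : ℂ} (h : HasVDerivAt s d x)
    (h' : HasVDerivAt s' d' x) : HasVDerivAt (fun y => s y + s' y) (d + d') x := fun φ => by
  simpa using (h φ).fun_add (h' φ)

theorem HasVDerivAt.const_smul {s : ℂ → M} {d : M} {x : ℂ} (h : HasVDerivAt s d x) (r : ℂ) :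
    HasVDerivAt (fun y => r • s y) (r • d) x := fun φ => by
  simpa using (h φ).const_mul r

theorem HasVDerivAt.sum {ι : Type*} (t : Finset ι) {s : ι → ℂ → M} {d : ι → M} {x : ℂ}
    (h : ∀ i ∈ t, HasVDerivAt (s i) (d i) x) :
    HasVDerivAt (fun y => ∑ i ∈ t, s i y) (∑ i ∈ t, d i) x := fun φ => by
  simpa using HasDerivAt.fun_sum fun i hi => h i hi φ

theorem hasVDerivAt_smul {f : ℂ → ℂ} {f' : ℂ} {x : ℂ} (h : HasDerivAt f f' x) (e : M) :
    HasVDerivAt (fun y => f y • e) (f' • e) x := fun φ => by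
  simpa using h.mul_const (φ e)

theorem vderiv_linearEquiv {M' : Type*} [AddCommGroup M'] [Module ℂ M'] (A : M ≃ₗ[ℂ] M')
    (s : ℂ → M) (x : ℂ) : vderiv (fun y => A (s y)) x = A (vderiv s x) := by
  by_cases hex : ∃ d : M, HasVDerivAt s d x
  · obtain ⟨d, hd⟩ := hex
    have : HasVDerivAt (fun y => A (s y)) (A d) x := fun φ => hd (φ ∘ₗ A.toLinearMap)
    rw [this.vderiv_eq, hd.vderiv_eq]
  · have hex' : ¬ ∃ d : M', HasVDerivAt (fun y => A (s y)) d x := by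
      rintro ⟨d, hd⟩
      refine hex ⟨A.symm d, fun φ => ?_⟩
      simpa using hd (φ ∘ₗ A.symm.toLinearMap)
    unfold HasVDerivAt at hex hex'
    rw [vderiv, vderiv, dif_neg hex, dif_neg hex', map_zero]

theorem vderiv_congr {s s' : ℂ → M} {τ : ℂ} (h : s =ᶠ[𝓝 τ] s') : vderiv s =ᶠ[𝓝 τ] vderiv s' := by
  filter_upwards [h.eventually_nhds] with x hx
  have : (∃ d : M, HasVDerivAt s d x) ↔ ∃ d : M, HasVDerivAt s' d x :=
    ⟨fun ⟨d, hd⟩ => ⟨d, hd.congr (EventuallyEq.symm hx)⟩, fun ⟨d, hd⟩ => ⟨d, hd.congr hx⟩⟩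
  by_cases hex : ∃ d : M, HasVDerivAt s d x
  · obtain ⟨d, hd⟩ := hex
    rw [hd.vderiv_eq, (hd.congr (EventuallyEq.symm hx)).vderiv_eq]
  · have hex' := mt this.2 hex
    unfold HasVDerivAt at hex hex'
    rw [vderiv, vderiv, dif_neg hex, dif_neg hex']

theorem coe_mem_holGerm_iff {F : ℂ → M} {τ : ℂ} :
    (F : Germ (𝓝 τ) M) ∈ holGerm M τ ↔ ∃ (n : ℕ) (f : Fin n → ℂ → ℂ) (e : Fin n → M),
      (∀ i, AnalyticAt ℂ (f i) τ) ∧ F =ᶠ[𝓝 τ] fun x => ∑ i, f i x • e i := by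
  have hsum : ∀ {n : ℕ} (s : Fin n → ℂ → M),
      (∑ i, (s i : Germ (𝓝 τ) M)) = ((fun x => ∑ i, s i x : ℂ → M) : Germ (𝓝 τ) M) := by
    intro n s
    have := map_sum (Germ.coeAddHom (M := M) (𝓝 τ)) s Finset.univ
    rw [show (fun x => ∑ i, s i x) = ∑ i, s i from funext fun x => by simp]
    exact this.symm
  constructor
  · intro h
    obtain ⟨n, r, g, hg⟩ := Submodule.mem_span_set'.1 h
    choose f e hf hfe using fun i => (g i).2
    refine ⟨n, fun i x => r i * f i x, e, fun i => analyticAt_const.mul (hf i), ?_⟩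
    rw [← Germ.coe_eq, ← hg, ← hsum fun i x => (r i * f i x) • e i]
    refine Finset.sum_congr rfl fun i _ => ?_
    rw [hfe, ← Germ.coe_smul]
    exact congrArg _ (funext fun x => by simp [mul_smul])
  · rintro ⟨n, f, e, hf, hF⟩
    rw [Germ.coe_eq.2 hF, ← hsum fun i x => f i x • e i]
    exact Submodule.sum_mem _ fun i _ => Submodule.subset_span ⟨f i, e i, hf i, rfl⟩

theorem sum_smul_mem_holGerm {ι : Type*} (t : Finset ι) {f : ι → ℂ → ℂ} {τ : ℂ}
    (hf : ∀ i ∈ t, AnalyticAt ℂ (f i) τ) (e : ι → M) :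
    ((fun x => ∑ i ∈ t, f i x • e i : ℂ → M) : Germ (𝓝 τ) M) ∈ holGerm M τ := by
  have := map_sum (Germ.coeAddHom (M := M) (𝓝 τ)) (fun i x => f i x • e i) t
  rw [show (fun x => ∑ i ∈ t, f i x • e i) = ∑ i ∈ t, fun x => f i x • e i from
    funext fun x => by simp]
  change Germ.coeAddHom (𝓝 τ) _ ∈ _
  rw [this]
  exact Submodule.sum_mem _ fun i hi => Submodule.subset_span ⟨f i, e i, hf i hi, rfl⟩

theorem coe_add_mem_holGerm {F G : ℂ → M} {τ : ℂ} (hF : (F : Germ (𝓝 τ) M) ∈ holGerm M τ)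
    (hG : (G : Germ (𝓝 τ) M) ∈ holGerm M τ) :
    ((fun x => F x + G x : ℂ → M) : Germ (𝓝 τ) M) ∈ holGerm M τ :=
  Submodule.add_mem _ hF hG

theorem eventually_hasVDerivAt {F : ℂ → M} {τ : ℂ} (hF : (F : Germ (𝓝 τ) M) ∈ holGerm M τ) :
    ∀ᶠ x in 𝓝 τ, HasVDerivAt F (vderiv F x) x := by
  obtain ⟨n, f, e, hf, hFe⟩ := coe_mem_holGerm_iff.1 hF
  filter_upwards [eventually_all.2 fun i => (hf i).eventually_analyticAt, hFe.eventually_nhds]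
    with x hx hx'
  have : HasVDerivAt F (∑ i, deriv (f i) x • e i) x :=
    (HasVDerivAt.sum Finset.univ fun i _ =>
      hasVDerivAt_smul (hx i).differentiableAt.hasDerivAt (e i)).congr hx'
  rwa [this.vderiv_eq]

theorem vderiv_mem_holGerm {F : ℂ → M} {τ : ℂ} (hF : (F : Germ (𝓝 τ) M) ∈ holGerm M τ) :
    (vderiv F : Germ (𝓝 τ) M) ∈ holGerm M τ := by
  obtain ⟨n, f, e, hf, hFe⟩ := coe_mem_holGerm_iff.1 hF
  refine coe_mem_holGerm_iff.2 ⟨n, fun i => deriv (f i), e, fun i => (hf i).deriv, ?_⟩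
  filter_upwards [eventually_all.2 fun i => (hf i).eventually_analyticAt, hFe.eventually_nhds]
    with x hx hx'
  exact ((HasVDerivAt.sum Finset.univ fun i _ =>
      hasVDerivAt_smul (hx i).differentiableAt.hasDerivAt (e i)).congr hx').vderiv_eq

end VectorValued

/-! ### Holomorphic families of Laurent series acting on vector-valued functions -/

theorem HasSeriesDeriv.analyticAt_coeff {W : Set ℂ} {c c' : ℂ → FormalK}
    (h : HasSeriesDeriv W c c') {τ : ℂ} (hτ : τ ∈ W) (n : ℤ) :
    AnalyticAt ℂ (fun x => (c x).coeff n) τ := by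
  obtain ⟨k, hk⟩ := h τ hτ
  exact Complex.analyticAt_iff_eventually_differentiableAt.2
    (hk.mono fun x hx => (hx.2 n).differentiableAt)

section LieModule

variable {M : Type*} [AddCommGroup M] [Module ℂ M] [LieRingModule DerK M]

/-- The operator `∂_τ + c(τ)∂_z` on vector-valued functions. -/
def nabla (c : ℂ → FormalK) (F : ℂ → M) (x : ℂ) : M := vderiv F x + ⁅vf (c x), F x⁆

theorem nabla_congr {c : ℂ → FormalK} {F F' : ℂ → M} {τ : ℂ} (h : F =ᶠ[𝓝 τ] F') :
    nabla c F =ᶠ[𝓝 τ] nabla c F' := by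
  filter_upwards [h, vderiv_congr h] with x hx hx'
  rw [nabla, nabla, hx, hx']

theorem nabla_add {c : ℂ → FormalK} {F F' : ℂ → M} {τ : ℂ}
    (hF : (F : Germ (𝓝 τ) M) ∈ holGerm M τ) (hF' : (F' : Germ (𝓝 τ) M) ∈ holGerm M τ) :
    nabla c (fun x => F x + F' x) =ᶠ[𝓝 τ] fun x => nabla c F x + nabla c F' x := by
  filter_upwards [eventually_hasVDerivAt hF, eventually_hasVDerivAt hF'] with x hx hx'
  rw [nabla, nabla, nabla, (hx.add hx').vderiv_eq, lie_add]
  abel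

variable [LieModule ℂ DerK M]

variable (M) in
/-- Continuity of the action of `Der 𝒦` for the discrete topology on `M`. -/
def IsSmooth : Prop :=
  ∀ v : M, ∃ N : ℤ, ∀ f : FormalK, (∀ n < N, f.coeff n = 0) → ⁅vf f, v⁆ = 0

/-- Removing the terms of degree in `[k, N)` leaves a series in `z^N 𝒪`, which kills `v`. Hence only
these terms act. -/
theorem lie_eq_sum {v : M} {N : ℤ}
    (hN : ∀ f : FormalK, (∀ n < N, f.coeff n = 0) → ⁅vf f, v⁆ = 0) {c : FormalK} {k : ℤ}
    (hc : ∀ n < k, c.coeff n = 0) :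
    ⁅vf c, v⁆ = ∑ n ∈ Finset.Ico k N, c.coeff n • ⁅vf (HahnSeries.single n 1), v⁆ := by
  have h := hN (c - ∑ n ∈ Finset.Ico k N, c.coeff n • HahnSeries.single n (1 : ℂ)) fun m hm => by
    rw [HahnSeries.coeff_sub, HahnSeries.coeff_sum]
    simp only [HahnSeries.coeff_smul, HahnSeries.coeff_single, smul_eq_mul, mul_ite, mul_one,
      mul_zero, Finset.sum_ite_eq, Finset.mem_Ico]
    by_cases hk : k ≤ m
    · simp [hk, hm]
    · simp [hk, hc m (not_le.1 hk)]
  rw [map_sub, sub_lie, sub_eq_zero] at h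
  rw [h, map_sum, sum_lie]
  simp only [map_smul, smul_lie]

/-- Locally `F` involves finitely many vectors and the pole order of `c` is bounded, so one finite
set of pairs (vector, degree) serves all nearby points. Both claims then follow from the product
rule for scalar functions. -/
theorem lie_holomorphic (hM : IsSmooth M) {W : Set ℂ} {c c' : ℂ → FormalK}
    (h : HasSeriesDeriv W c c') {τ : ℂ} (hτ : τ ∈ W) {F : ℂ → M}
    (hF : (F : Germ (𝓝 τ) M) ∈ holGerm M τ) :
    ((fun x => ⁅vf (c x), F x⁆ : ℂ → M) : Germ (𝓝 τ) M) ∈ holGerm M τ ∧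
    ∀ᶠ x in 𝓝 τ, HasVDerivAt (fun y => ⁅vf (c y), F y⁆)
      (⁅vf (c' x), F x⁆ + ⁅vf (c x), vderiv F x⁆) x := by
  obtain ⟨n, f, e, hf, hFe⟩ := coe_mem_holGerm_iff.1 hF
  choose N hN using hM
  obtain ⟨k, hk⟩ := h τ hτ
  set t : Finset ((_ : Fin n) × ℤ) := Finset.univ.sigma fun i => Finset.Ico (-k : ℤ) (N (e i))
  set E : (_ : Fin n) × ℤ → M := fun j => ⁅vf (HahnSeries.single j.2 1), e j.1⁆
  have hlie : ∀ (d : FormalK), (∀ m < -(k : ℤ), d.coeff m = 0) → ∀ b : Fin n → ℂ,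
      ⁅vf d, ∑ i, b i • e i⁆ = ∑ j ∈ t, (b j.1 * d.coeff j.2) • E j := fun d hd b => by
    rw [lie_sum, Finset.sum_sigma]
    refine Finset.sum_congr rfl fun i _ => ?_
    rw [lie_smul, lie_eq_sum (hN (e i)) hd, Finset.smul_sum]
    simp only [smul_smul, E]
  have hEq : (fun x => ⁅vf (c x), F x⁆) =ᶠ[𝓝 τ]
      fun x => ∑ j ∈ t, (f j.1 x * (c x).coeff j.2) • E j := by
    filter_upwards [hFe, hk] with x hx hx'
    rw [hx, hlie _ fun m hm => (hx'.1 m hm).1]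
  constructor
  · rw [Germ.coe_eq.2 hEq]
    exact sum_smul_mem_holGerm t (fun j _ => (hf j.1).mul (h.analyticAt_coeff hτ j.2)) E
  · filter_upwards [hk, hEq.eventually_nhds, hFe.eventually_nhds,
      eventually_all.2 fun i => (hf i).eventually_analyticAt] with x hx hx' hxF hfx
    have hdF : HasVDerivAt F (∑ i, deriv (f i) x • e i) x :=
      (HasVDerivAt.sum Finset.univ fun i _ =>
        hasVDerivAt_smul (hfx i).differentiableAt.hasDerivAt (e i)).congr hxF
    rw [hdF.vderiv_eq, hxF.self_of_nhds, hlie _ fun m hm => (hx.1 m hm).2,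
      hlie _ fun m hm => (hx.1 m hm).1, ← Finset.sum_add_distrib]
    refine HasVDerivAt.congr ?_ hx'
    refine HasVDerivAt.sum t fun j _ => ?_
    rw [← add_smul, add_comm]
    exact hasVDerivAt_smul ((hfx j.1).differentiableAt.hasDerivAt.fun_mul (hx.2 j.2)) (E j)

theorem nabla_mem_holGerm (hM : IsSmooth M) {W : Set ℂ} {c c' : ℂ → FormalK}
    (h : HasSeriesDeriv W c c') {τ : ℂ} (hτ : τ ∈ W) {F : ℂ → M}
    (hF : (F : Germ (𝓝 τ) M) ∈ holGerm M τ) :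
    (nabla c F : Germ (𝓝 τ) M) ∈ holGerm M τ :=
  coe_add_mem_holGerm (vderiv_mem_holGerm hF) (lie_holomorphic hM h hτ hF).1

theorem nabla_smul {c : ℂ → FormalK} {F : ℂ → M} {τ : ℂ}
    (hF : (F : Germ (𝓝 τ) M) ∈ holGerm M τ) (r : ℂ) :
    nabla c (fun x => r • F x) =ᶠ[𝓝 τ] fun x => r • nabla c F x := by
  filter_upwards [eventually_hasVDerivAt hF] with x hx
  rw [nabla, nabla, (hx.const_smul r).vderiv_eq, lie_smul, smul_add]

/-- The Leibniz rule produces `d'`, and moving `c` past `d` produces the bracket `[c∂_z, d∂_z]`. -/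
theorem nabla_lie (hM : IsSmooth M) {W : Set ℂ} {c d d' : ℂ → FormalK}
    (hd : HasSeriesDeriv W d d') {τ : ℂ} (hτ : τ ∈ W) {F : ℂ → M}
    (hF : (F : Germ (𝓝 τ) M) ∈ holGerm M τ) :
    nabla c (fun x => ⁅vf (d x), F x⁆) =ᶠ[𝓝 τ] fun x =>
      ⁅vf (d' x + (c x * dz (d x) - d x * dz (c x))), F x⁆ + ⁅vf (d x), nabla c F x⁆ := by
  filter_upwards [(lie_holomorphic hM hd hτ hF).2] with x hx
  have hb : vf (c x * dz (d x) - d x * dz (c x)) = ⁅vf (c x), vf (d x)⁆ := by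
    simp [bracket_def]
  rw [nabla, nabla, hx.vderiv_eq, map_add, add_lie, hb, lie_lie, lie_add]
  abel

end LieModule

/-! ### Flat sections of the localisation -/

section FlatSections

variable (V : Type*) [AddCommGroup V] [Module ℂ V] [DistribMulAction AutO V]
  [SMulCommClass AutO ℂ V]

/-- The trivialisation `frame`, as a linear isomorphism. -/
def frameEquiv : V ≃ₗ[ℂ] Assoc V :=
  LinearEquiv.ofBijective (frame V) (by
    constructor
    · intro v w h
      have h1 : (frame V v).1 1 = (frame V w).1 1 := by rw [h]
      have h2 : (1 : AutO)⁻¹ • v = (1 : AutO)⁻¹ • w := h1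
      simpa using h2
    · intro F
      refine ⟨F.1 1, Subtype.ext (funext fun ρ => ?_)⟩
      have := F.2 1 ρ
      rw [one_mul] at this
      exact this.symm)

variable {V}

theorem frameEquiv_apply (v : V) : frameEquiv V v = frame V v := rfl

variable [LieRingModule DerK V] [IsHCModule V]

theorem mk_eq_mk_iff {τ : ℂ} {F G : ℂ → Assoc V}
    (hF : (F : Germ (𝓝 τ) (Assoc V)) ∈ holGerm (Assoc V) τ)
    (hG : (G : Germ (𝓝 τ) (Assoc V)) ∈ holGerm (Assoc V) τ) :
    DeltaStalk.mk τ F hF = DeltaStalk.mk τ G hG ↔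
      ((fun x => F x - G x : ℂ → Assoc V) : Germ (𝓝 τ) (Assoc V)) ∈ stabGerm V τ :=
  Submodule.Quotient.eq _

theorem mk_eq_zero_iff {τ : ℂ} {F : ℂ → Assoc V}
    (hF : (F : Germ (𝓝 τ) (Assoc V)) ∈ holGerm (Assoc V) τ) :
    DeltaStalk.mk τ F hF = 0 ↔ (F : Germ (𝓝 τ) (Assoc V)) ∈ stabGerm V τ :=
  Submodule.Quotient.mk_eq_zero _

/-- This is the `Aut 𝒪`-equivariance of the action of `Der 𝒦`. It transports the module structure
and its smoothness from `V` to the fibres of the associated bundle. -/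
theorem act_frame (D : DerK) (v : V) : act D (frame V v) = frame V ⁅D, v⁆ :=
  Subtype.ext (funext fun ρ => (IsHCModule.smul_lie ρ⁻¹ D v).symm)

instance : LieRingModule DerK (Assoc V) where
  bracket := act
  add_lie D D' F := by
    obtain ⟨v, rfl⟩ := (frameEquiv V).surjective F
    simp only [frameEquiv_apply, act_frame, add_lie, map_add]
  lie_add D F F' := by
    obtain ⟨v, rfl⟩ := (frameEquiv V).surjective F
    obtain ⟨v', rfl⟩ := (frameEquiv V).surjective F'
    simp only [frameEquiv_apply, ← map_add, act_frame, lie_add]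
  leibniz_lie D D' F := by
    obtain ⟨v, rfl⟩ := (frameEquiv V).surjective F
    simp only [frameEquiv_apply, act_frame, ← map_add, leibniz_lie D D' v]

theorem lie_frame (D : DerK) (v : V) : ⁅D, frame V v⁆ = frame V ⁅D, v⁆ := act_frame D v

theorem lie_mem_stabGerm {W : Set ℂ} (hW : IsOpen W) (hWU : W ⊆ upperHalf) {τ : ℂ} (hτ : τ ∈ W)
    {c : ℂ → FormalK} (hc : IsLift W (fun _ => 0) c) {F : ℂ → Assoc V}
    (hF : (F : Germ (𝓝 τ) (Assoc V)) ∈ holGerm (Assoc V) τ) :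
    ((fun x => ⁅vf (c x), F x⁆ : ℂ → Assoc V) : Germ (𝓝 τ) (Assoc V)) ∈ stabGerm V τ :=
  Submodule.subset_span ⟨W, c, F, hW, hWU, hτ, hc, hF, rfl⟩

theorem isSmooth_assoc : IsSmooth (Assoc V) := fun F => by
  obtain ⟨v, rfl⟩ := (frameEquiv V).surjective F
  obtain ⟨N, hN⟩ := IsHCModule.continuous_lie v
  exact ⟨N, fun f hf => by rw [frameEquiv_apply, lie_frame, hN f hf, map_zero]⟩

variable [LieModule ℂ DerK V]

instance : LieModule ℂ DerK (Assoc V) where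
  smul_lie r D F := by
    obtain ⟨v, rfl⟩ := (frameEquiv V).surjective F
    simp only [frameEquiv_apply, lie_frame, smul_lie, map_smul]
  lie_smul r D F := by
    obtain ⟨v, rfl⟩ := (frameEquiv V).surjective F
    simp only [frameEquiv_apply, ← map_smul, lie_frame, lie_smul]

omit [SMulCommClass AutO ℂ V] in
-- The residue pairs `L_n` with the coefficient of index `n + 1`, and `L_n = -z^{n+1}∂_z`.
-- Smoothness and the bounded pole leave finitely many terms on both sides.
theorem resL_eq (c : FormalK) (v : V) : resL c v = -⁅vf c, v⁆ := by
  obtain ⟨N, hN⟩ := IsHCModule.continuous_lie v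
  obtain ⟨k, p, rfl⟩ := exists_eq_single_neg_mul c
  have hc := fun n (hn : n < -(k : ℤ)) => coeff_single_neg_mul_of_lt k p hn
  have hL : ∀ n : ℤ, ⁅L n, v⁆ = -⁅vf (HahnSeries.single (n + 1) 1), v⁆ := fun n => by
    have : L n = -vf (HahnSeries.single (n + 1) 1) := by
      rw [← map_neg, L]
      congr 1
      ext m
      simp only [HahnSeries.coeff_single, HahnSeries.coeff_neg]
      split_ifs <;> simp
    rw [this, neg_lie]
  rw [lie_eq_sum hN hc, resL]
  generalize (HahnSeries.single (-(k : ℤ)) 1 * HahnSeries.ofPowerSeries ℤ ℂ p : FormalK) = c at hc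
  have hsh : ∑ᶠ n : ℤ, c.coeff (n + 1) • ⁅L n, v⁆ =
      ∑ᶠ n : ℤ, -(c.coeff n • ⁅vf (HahnSeries.single n 1), v⁆) := by
    rw [← finsum_comp_equiv (Equiv.addRight (1 : ℤ))
      (f := fun n : ℤ => -(c.coeff n • ⁅vf (HahnSeries.single n 1), v⁆))]
    exact finsum_congr fun n => by simp [hL]
  rw [hsh, ← Finset.sum_neg_distrib]
  refine finsum_eq_sum_of_support_subset _ fun n hn => ?_
  rw [Finset.coe_Ico, Set.mem_Ico]
  by_contra hlt
  refine hn ?_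
  rcases lt_or_ge n (-(k : ℤ)) with h | h
  · simp [hc n h]
  · have : N ≤ n := by
      by_contra h'
      exact hlt ⟨h, not_le.1 h'⟩
    have h0 := hN (HahnSeries.single n 1) fun m hm => HahnSeries.coeff_single_of_ne (by lia)
    simp [h0]

theorem nabla_frame (c : ℂ → FormalK) (s : ℂ → V) (x : ℂ) :
    nabla c (fun y => frame V (s y)) x = frame V (vderiv s x - resL (c x) (s x)) := by
  rw [nabla, lie_frame, resL_eq, sub_neg_eq_add, map_add]
  congr 1
  exact vderiv_linearEquiv (frameEquiv V) s x

variable (V) in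
theorem stabGerm_le_holGerm (τ : ℂ) : stabGerm V τ ≤ holGerm (Assoc V) τ := by
  refine Submodule.span_le.2 ?_
  rintro _ ⟨W, c, F, hW, -, hτ, hc, hF, rfl⟩
  obtain ⟨c', hc'⟩ := hc.exists_hasSeriesDeriv hW
  exact (lie_holomorphic isSmooth_assoc hc' hτ hF).1

/-- The operator `∂_τ + c(τ)∂_z` preserves `𝔤⁰ · 𝒱`. -/
theorem nabla_mem_stabGerm {c : ℂ → FormalK} (hc : IsLift upperHalf (fun _ => 1) c) {τ : ℂ}
    {F : ℂ → Assoc V} (hF : (F : Germ (𝓝 τ) (Assoc V)) ∈ stabGerm V τ) :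
    (nabla c F : Germ (𝓝 τ) (Assoc V)) ∈ stabGerm V τ := by
  suffices h : ∀ g ∈ stabGerm V τ, ∀ s : ℂ → Assoc V, (s : Germ (𝓝 τ) (Assoc V)) = g →
      (nabla c s : Germ (𝓝 τ) (Assoc V)) ∈ stabGerm V τ from h _ hF F rfl
  intro g hg
  induction hg using Submodule.span_induction with
  | mem g hg =>
    rintro s rfl
    obtain ⟨W, d, G, hW, hWU, hτ, hd, hG, hs⟩ := hg
    obtain ⟨c', hc'⟩ := hc.exists_hasSeriesDeriv isOpen_upperHalf
    obtain ⟨d', hd', hdl⟩ := (hc.mono hWU).bracket hW hWU hd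
    -- On a generator `d·G`, the commutator formula gives a sum of two generators, one for the lift
    -- `d' + [c,d]` of `0` and one for `d` itself.
    have hEq := (nabla_congr (c := c) (Germ.coe_eq.1 hs)).trans
      (nabla_lie (c := c) isSmooth_assoc hd' hτ hG)
    rw [Germ.coe_eq.2 hEq]
    exact Submodule.add_mem _ (lie_mem_stabGerm hW hWU hτ hdl hG)
      (lie_mem_stabGerm hW hWU hτ hd (nabla_mem_holGerm isSmooth_assoc hc' (hWU hτ) hG))
  | zero =>
    intro s hs
    have h0 : s =ᶠ[𝓝 τ] fun _ => (0 : ℂ) • (0 : Assoc V) := by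
      simpa using (Germ.coe_eq (g := fun _ => (0 : Assoc V))).1 hs
    have hz : (((fun _ => 0 : ℂ → Assoc V)) : Germ (𝓝 τ) (Assoc V)) ∈ holGerm (Assoc V) τ :=
      Submodule.zero_mem _
    have hEq := (nabla_congr (c := c) h0).trans (nabla_smul (c := c) hz 0)
    simp only [zero_smul] at hEq
    rw [Germ.coe_eq.2 hEq]
    exact Submodule.zero_mem _
  | add g g' hg hg' ih ih' =>
    intro s hs
    induction g using Germ.inductionOn with | _ u
    induction g' using Germ.inductionOn with | _ u'
    have hEq := (nabla_congr (c := c) (Germ.coe_eq.1 hs)).trans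
      (nabla_add (c := c) (stabGerm_le_holGerm V τ hg) (stabGerm_le_holGerm V τ hg'))
    rw [Germ.coe_eq.2 hEq]
    exact Submodule.add_mem _ (ih u rfl) (ih' u' rfl)
  | smul r g hg ih =>
    intro s hs
    induction g using Germ.inductionOn with | _ u
    have hEq := (nabla_congr (c := c) (Germ.coe_eq.1 hs)).trans
      (nabla_smul (c := c) (stabGerm_le_holGerm V τ hg) r)
    rw [Germ.coe_eq.2 hEq]
    exact Submodule.smul_mem _ r (ih u rfl)

/-- The connection may be computed with any representative and any lift of `∂_τ`. -/
theorem nablaRel_zero_iff {c : ℂ → FormalK} (hc : IsLift upperHalf (fun _ => 1) c) {τ : ℂ}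
    (hτ : τ ∈ upperHalf) {F : ℂ → Assoc V}
    (hF : (F : Germ (𝓝 τ) (Assoc V)) ∈ holGerm (Assoc V) τ) :
    NablaRel τ (DeltaStalk.mk τ F hF) 0 ↔
      (nabla c F : Germ (𝓝 τ) (Assoc V)) ∈ stabGerm V τ := by
  obtain ⟨c', hc'⟩ := hc.exists_hasSeriesDeriv isOpen_upperHalf
  constructor
  · rintro ⟨W, d, G, hG, hG', hW, hWU, hτW, hd, hFG, h0⟩
    have h0' : (nabla d G : Germ (𝓝 τ) (Assoc V)) ∈ stabGerm V τ := (mk_eq_zero_iff hG').1 h0.symm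
    have hFG' := nabla_mem_stabGerm hc ((mk_eq_mk_iff hF hG).1 hFG)
    have hcd := lie_mem_stabGerm hW hWU hτW (c := fun x => c x - d x)
      (by simpa using (hc.mono hWU).sub hd) hG
    -- All three terms lie in `𝔤⁰·𝒱`: the first because `∇_c` preserves it, the second by
    -- assumption, and the last because `c - d` is the expansion of a vertical vector field.
    have hEq : nabla c F =ᶠ[𝓝 τ] fun x =>
        nabla c (fun y => F y - G y) x + (nabla d G x + ⁅vf (c x - d x), G x⁆) := by
      have hdiff : ((fun x => F x - G x : ℂ → Assoc V) : Germ (𝓝 τ) (Assoc V)) ∈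
        holGerm (Assoc V) τ := Submodule.sub_mem _ hF hG
      have h1 := nabla_add (c := c) hdiff hG
      simp only [sub_add_cancel] at h1
      filter_upwards [h1] with x hx
      have h2 : nabla c F x = nabla c (fun y => F y - G y) x + nabla c G x := hx
      rw [h2]
      simp only [nabla, map_sub, sub_lie]
      abel
    rw [Germ.coe_eq.2 hEq]
    exact Submodule.add_mem _ hFG' (Submodule.add_mem _ h0' hcd)
  · intro h
    have hn := nabla_mem_holGerm isSmooth_assoc hc' hτ hF
    exact ⟨upperHalf, c, F, hF, hn, isOpen_upperHalf, subset_rfl, hτ, hc, rfl,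
      ((mk_eq_zero_iff hn).2 h).symm⟩

/-- Any section of the associated bundle is `frame` of a unique `V`-valued function, for which `∇_c`
is the operator of the differential equation. Flatness can be tested on a single representative, so
a local lift suffices for the converse. -/
theorem isFlat_iff {c : ℂ → FormalK} (hc : IsLift upperHalf (fun _ => 1) c) {U : Set ℂ}
    (hU : U ⊆ upperHalf) (σ : DeltaSection V U) :
    σ.IsFlat ↔ ∀ (τ : U) (s : ℂ → V)
        (hs : ((fun x => frame V (s x) : ℂ → Assoc V) : Germ (𝓝 (τ : ℂ)) (Assoc V)) ∈
          holGerm (Assoc V) (τ : ℂ)),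
        σ.germ τ = DeltaStalk.mk (τ : ℂ) (fun x => frame V (s x)) hs →
        ∃ hs' : ((fun x => frame V (vderiv s x - resL (c x) (s x)) : ℂ → Assoc V) :
            Germ (𝓝 (τ : ℂ)) (Assoc V)) ∈ holGerm (Assoc V) (τ : ℂ),
          DeltaStalk.mk (τ : ℂ)
            (fun x => frame V (vderiv s x - resL (c x) (s x))) hs' = 0 := by
  simp only [← nabla_frame]
  obtain ⟨c', hc'⟩ := hc.exists_hasSeriesDeriv isOpen_upperHalf
  constructor
  · intro hflat τ s hs hσ
    have h1 := hflat τ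
    rw [hσ, nablaRel_zero_iff hc (hU τ.2) hs] at h1
    exact ⟨nabla_mem_holGerm isSmooth_assoc hc' (hU τ.2) hs, (mk_eq_zero_iff _).2 h1⟩
  · intro h τ
    obtain ⟨F, hF⟩ := σ.locally_lifts τ
    obtain ⟨hFh, hFσ⟩ := hF.self_of_nhds τ.2
    obtain ⟨s, rfl⟩ : ∃ s : ℂ → V, F = fun x => frame V (s x) :=
      ⟨fun x => (frameEquiv V).symm (F x), funext fun x =>
        ((frameEquiv V).apply_symm_apply (F x)).symm⟩
    obtain ⟨hs', h0⟩ := h τ s hFh hFσ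
    change NablaRel (τ : ℂ) (σ.germ ⟨τ, τ.2⟩) 0
    rw [hFσ, nablaRel_zero_iff hc (hU τ.2) hFh]
    exact (mk_eq_zero_iff hs').1 h0

end FlatSections

/-! ### Analyticity of series of products of functions of separate variables -/

/-- The sum is the pairing of the `ℓ²`-valued function `∑ f_n(x) e_n` with the functional-valued `∑
g_n(y) ev_n`. Each is holomorphic in one variable by uniform convergence, and a continuous bilinear
pairing preserves joint analyticity. -/
theorem analyticAt_tsum_mul {f g : ℕ → ℂ → ℂ} {A B : ℕ → ℝ} (hA : Summable A) (hB : Summable B)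
    {U U' : Set ℂ} (hU : IsOpen U) (hU' : IsOpen U')
    (hf : ∀ n, DifferentiableOn ℂ (f n) U) (hg : ∀ n, DifferentiableOn ℂ (g n) U')
    (hfA : ∀ n, ∀ x ∈ U, ‖f n x‖ ≤ A n) (hgB : ∀ n, ∀ y ∈ U', ‖g n y‖ ≤ B n)
    {x y : ℂ} (hx : x ∈ U) (hy : y ∈ U') :
    AnalyticAt ℂ (fun p : ℂ × ℂ => ∑' n, f n p.1 * g n p.2) (x, y) := by
  let E := lp (fun _ : ℕ => ℂ) 2
  let e : ℕ → E := fun n => lp.single 2 n 1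
  let ev : ℕ → E →L[ℂ] ℂ := fun n => lp.evalCLM ℂ (fun _ : ℕ => ℂ) 2 n
  have he : ∀ n, ‖e n‖ ≤ 1 := fun n => by
    simp only [e]; rw [lp.norm_single (by norm_num)]; simp
  have hev : ∀ n, ‖ev n‖ ≤ 1 := fun n => by
    refine ContinuousLinearMap.opNorm_le_bound _ zero_le_one fun v => ?_
    rw [one_mul]
    exact lp.norm_apply_le_norm (by norm_num) v n
  have heve : ∀ m n, ev m (e n) = if m = n then 1 else 0 := fun m n => by
    simp only [ev, e]
    change (lp.single 2 n (1 : ℂ) : E) m = _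
    rw [lp.single_apply, Pi.single_apply]
  have bf : ∀ n, ∀ w ∈ U, ‖f n w • e n‖ ≤ A n := fun n w hw => by
    rw [norm_smul]
    exact (mul_le_of_le_one_right (norm_nonneg _) (he n)).trans (hfA n w hw)
  have bg : ∀ n, ∀ w ∈ U', ‖g n w • ev n‖ ≤ B n := fun n w hw => by
    rw [norm_smul]
    exact (mul_le_of_le_one_right (norm_nonneg _) (hev n)).trans (hgB n w hw)
  have dS := Complex.differentiableOn_tsum_of_summable_norm hA
    (fun n => (hf n).smul_const (e n)) hU bf
  have dT := Complex.differentiableOn_tsum_of_summable_norm hB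
    (fun n => (hg n).smul_const (ev n)) hU' bg
  have aS := (dS.analyticAt (hU.mem_nhds hx)).comp_of_eq
    (analyticAt_fst (𝕜 := ℂ) (p := (x, y))) rfl
  have aT := (dT.analyticAt (hU'.mem_nhds hy)).comp_of_eq
    (analyticAt_snd (𝕜 := ℂ) (p := (x, y))) rfl
  have pairing : AnalyticAt ℂ (fun p : ℂ × ℂ =>
      (∑' n, g n p.2 • ev n) (∑' n, f n p.1 • e n)) (x, y) :=
    AnalyticAt.comp₂ (h := fun q : (E →L[ℂ] ℂ) × E => q.1 q.2)
      ((ContinuousLinearMap.apply ℂ ℂ : E →L[ℂ] (E →L[ℂ] ℂ) →L[ℂ] ℂ).flip.analyticAt_bilinear _)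
      aT aS
  refine pairing.congr ?_
  filter_upwards [(hU.prod hU').mem_nhds (Set.mk_mem_prod hx hy)] with p hp
  have sS : HasSum (fun n => f n p.1 • e n) _ :=
    (Summable.of_norm_bounded hA fun n => bf n p.1 hp.1).hasSum
  have sT : HasSum (fun n => g n p.2 • ev n) _ :=
    (Summable.of_norm_bounded hB fun n => bg n p.2 hp.2).hasSum
  have hcoord : ∀ m, ev m (∑' n, f n p.1 • e n) = f m p.1 := fun m => by
    refine ((ev m).hasSum sS).unique ?_
    convert hasSum_single m fun n hn => ?_ using 1
    · simp [heve]
    · simp [heve, hn.symm]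
  have := (ContinuousLinearMap.apply ℂ ℂ (∑' n, f n p.1 • e n)).hasSum sT
  refine Eq.trans ?_ (this.tsum_eq.symm.trans (tsum_congr fun n => ?_))
  · simp
  · simp [hcoord, mul_comm]

/-! ### The generating function of the Bernoulli numbers -/

/-- The function `w / (e^w - 1)`, with value `1` at `w = 0`. -/
def todd (w : ℂ) : ℂ := (dslope Complex.exp 0 w)⁻¹

theorem analyticAt_todd : AnalyticAt ℂ todd 0 := by
  have h1 : Differentiable ℂ (dslope Complex.exp 0) := by
    have := (Complex.differentiableOn_dslope (c := 0) (f := Complex.exp) univ_mem).2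
      Complex.differentiable_exp.differentiableOn
    exact differentiableOn_univ.1 this
  refine (h1.analyticAt 0).inv ?_
  rw [dslope_same, Complex.deriv_exp, Complex.exp_zero]
  exact one_ne_zero

theorem todd_of_ne {w : ℂ} (hw : w ≠ 0) : todd w = w / (Complex.exp w - 1) := by
  rw [todd, dslope_of_ne _ hw, slope_def_field]
  simp

theorem expandsPS_exp : ExpandsPS Complex.exp (PowerSeries.exp ℂ) :=
  Eventually.of_forall fun z => by
    have := NormedSpace.expSeries_div_hasSum_exp z
    rw [← Complex.exp_eq_exp_ℂ] at this
    refine this.congr_fun fun n => ?_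
    simp [PowerSeries.coeff_exp, div_eq_inv_mul]

theorem ExpandsPS.const (a : ℂ) : ExpandsPS (fun _ => a) (PowerSeries.C a) :=
  Eventually.of_forall fun z => by
    convert hasSum_single (0 : ℕ) fun n hn => ?_ using 1
    · simp
    · simp [PowerSeries.coeff_C, hn]

theorem ExpandsPS.id : ExpandsPS (fun z => z) PowerSeries.X :=
  Eventually.of_forall fun z => by
    convert hasSum_single (1 : ℕ) fun n hn => ?_ using 1
    · simp
    · simp [PowerSeries.coeff_X, hn]

theorem ExpandsPS.add {G G' : ℂ → ℂ} {p p' : FormalO} (h : ExpandsPS G p)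
    (h' : ExpandsPS G' p') : ExpandsPS (fun z => G z + G' z) (p + p') := by
  filter_upwards [h, h'] with z hz hz'
  simpa [add_mul] using hz.add hz'

theorem ExpandsPS.sub {G G' : ℂ → ℂ} {p p' : FormalO} (h : ExpandsPS G p)
    (h' : ExpandsPS G' p') : ExpandsPS (fun z => G z - G' z) (p - p') := by
  filter_upwards [h, h'] with z hz hz'
  simpa [sub_mul] using hz.sub hz'

theorem ExpandsPS.rescale {G : ℂ → ℂ} {p : FormalO} (h : ExpandsPS G p) (a : ℂ) :
    ExpandsPS (fun z => G (a * z)) (PowerSeries.rescale a p) := by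
  have ht : Tendsto (fun z : ℂ => a * z) (𝓝 0) (𝓝 0) := by
    simpa using (continuous_const_mul a).tendsto 0
  filter_upwards [ht.eventually h] with z hz
  refine hz.congr_fun fun n => ?_
  rw [PowerSeries.coeff_rescale, mul_pow]
  ring

/-- Both series solve `p · (e^X - 1) = X`, and the factor `e^X - 1` can be cancelled. -/
theorem expandsPS_todd : ExpandsPS todd (bernoulliPowerSeries ℂ) := by
  have h1 := expandsPS_taylor analyticAt_todd
  generalize (PowerSeries.mk fun n => iteratedDeriv n todd 0 / (n.factorial : ℂ)) = p at h1
  have h2 := h1.mul (expandsPS_exp.sub (ExpandsPS.const 1))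
  have h3 : (fun z => todd z * (Complex.exp z - 1)) =ᶠ[𝓝 0] fun z => z := by
    have hne : ∀ᶠ z in 𝓝 (0 : ℂ), dslope Complex.exp 0 z ≠ 0 := by
      have hc : ContinuousAt (dslope Complex.exp 0) 0 :=
        continuousAt_dslope_same.2 Complex.differentiableAt_exp
      refine hc.eventually_ne ?_
      rw [dslope_same, Complex.deriv_exp, Complex.exp_zero]
      exact one_ne_zero
    filter_upwards [hne] with z hz
    by_cases h0 : z = 0
    · simp [h0]
    · have : Complex.exp z - 1 ≠ 0 := fun h => hz (by
        rw [dslope_of_ne _ h0, slope_def_field]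
        simp [h])
      rw [todd_of_ne h0, div_mul_cancel₀ _ this]
  have h4 := (h2.congr h3).unique ExpandsPS.id
  have h5 := bernoulliPowerSeries_mul_exp_sub_one ℂ
  rw [map_one] at h4
  have hne : PowerSeries.exp ℂ - 1 ≠ 0 := fun h => by
    rw [h, mul_zero] at h5
    exact PowerSeries.X_ne_zero h5.symm
  rwa [mul_right_cancel₀ hne (h5.trans h4.symm)]

/-- `ζ(2k)` is a multiple of `B_{2k}`, and it is a sum of nonnegative terms whose `n = 1` term is
`1`. -/
theorem bernoulli_two_mul_ne_zero {k : ℕ} (hk : k ≠ 0) : bernoulli (2 * k) ≠ 0 := by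
  intro h
  have hs := hasSum_zeta_nat hk
  rw [h] at hs
  simp only [Rat.cast_zero, mul_zero, zero_div] at hs
  have := (hasSum_zero_iff_of_nonneg fun n => by positivity).1 hs
  simpa using congrFun this 1

/-! ### The Lambert series -/

/-- `e^{2πiz}`. -/
def ex (z : ℂ) : ℂ := Complex.exp (2 * Real.pi * Complex.I * z)

theorem ex_ne_zero (z : ℂ) : ex z ≠ 0 := Complex.exp_ne_zero _

theorem ex_add (z w : ℂ) : ex (z + w) = ex z * ex w := by
  rw [ex, mul_add, Complex.exp_add]; rfl

theorem ex_intCast (n : ℤ) : ex n = 1 := by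
  rw [ex, Complex.exp_eq_one_iff]
  exact ⟨n, by ring⟩

theorem ex_eq_one_iff {z : ℂ} : ex z = 1 ↔ ∃ n : ℤ, z = n := by
  rw [ex, Complex.exp_eq_one_iff]
  refine exists_congr fun n => ?_
  rw [mul_comm (n : ℂ), mul_right_inj' Complex.two_pi_I_ne_zero]

theorem differentiable_ex : Differentiable ℂ ex := by
  unfold ex; fun_prop

theorem norm_ex (z : ℂ) : ‖ex z‖ = Real.exp (-(2 * Real.pi * z.im)) := by
  rw [ex, Complex.norm_exp]
  congr 1
  simp

theorem norm_ex_lt_one {z : ℂ} (hz : 0 < z.im) : ‖ex z‖ < 1 := by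
  rw [norm_ex, Real.exp_lt_one_iff, neg_lt_zero]
  have := Real.pi_pos
  positivity

/-- `q^{n+1} / (1 - q^{n+1})`. -/
def lam (q : ℂ) (n : ℕ) : ℂ := q ^ (n + 1) / (1 - q ^ (n + 1))

/-- `u^{n+1} - u^{-n-1}`. -/
def dif (u : ℂ) (n : ℕ) : ℂ := u ^ (n + 1) - (u ^ (n + 1))⁻¹

/-- `∑_{n ≥ 1} (uⁿ - u⁻ⁿ) qⁿ / (1 - qⁿ)`. -/
def lambert (q u : ℂ) : ℂ := ∑' n, lam q n * dif u n

theorem one_sub_pow_ne_zero {q : ℂ} (hq : ‖q‖ < 1) (n : ℕ) : 1 - q ^ (n + 1) ≠ 0 := by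
  intro h
  have : ‖q ^ (n + 1)‖ < 1 := by
    rw [norm_pow]
    exact pow_lt_one₀ (norm_nonneg _) hq n.succ_ne_zero
  rw [← sub_eq_zero.1 h, norm_one] at this
  exact lt_irrefl _ this

theorem norm_lam_le {q : ℂ} {r : ℝ} (hq : ‖q‖ ≤ r) (hr : r < 1) (n : ℕ) :
    ‖lam q n‖ ≤ (1 - r)⁻¹ * r ^ (n + 1) := by
  have hr0 : 0 ≤ r := (norm_nonneg q).trans hq
  have h1 : ‖q ^ (n + 1)‖ ≤ r ^ (n + 1) := by rw [norm_pow]; gcongr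
  have h2 : r ^ (n + 1) ≤ r := pow_le_of_le_one hr0 hr.le n.succ_ne_zero
  have h3 : 1 - r ≤ ‖1 - q ^ (n + 1)‖ := by
    have := norm_sub_norm_le (1 : ℂ) (q ^ (n + 1))
    rw [norm_one] at this
    linarith
  rw [lam, norm_div, div_eq_inv_mul]
  have : 0 < 1 - r := by linarith
  gcongr

theorem norm_dif_le {u : ℂ} {b : ℝ} (hu : ‖u‖ ≤ b) (hu' : ‖u‖⁻¹ ≤ b) (n : ℕ) :
    ‖dif u n‖ ≤ 2 * b ^ (n + 1) := by
  have h1 : ‖u ^ (n + 1)‖ ≤ b ^ (n + 1) := by rw [norm_pow]; gcongr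
  have h2 : ‖(u ^ (n + 1))⁻¹‖ ≤ b ^ (n + 1) := by
    rw [norm_inv, norm_pow, ← inv_pow]; gcongr
  rw [dif]
  linarith [norm_sub_le (u ^ (n + 1)) (u ^ (n + 1))⁻¹]

theorem norm_ex_le {z : ℂ} {b : ℝ} (hz : |z.im| ≤ b) :
    ‖ex z‖ ≤ Real.exp (2 * Real.pi * b) ∧ ‖ex z‖⁻¹ ≤ Real.exp (2 * Real.pi * b) := by
  have hp := Real.pi_pos
  obtain ⟨h1, h2⟩ := abs_le.1 hz
  rw [norm_ex, ← Real.exp_neg, Real.exp_le_exp, Real.exp_le_exp]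
  constructor <;> nlinarith

theorem summable_geometric_succ {r : ℝ} (h0 : 0 ≤ r) (h1 : r < 1) (C : ℝ) :
    Summable fun n : ℕ => C * r ^ (n + 1) :=
  (((summable_geometric_of_lt_one h0 h1).mul_left r).mul_left C).congr fun n => by
    rw [pow_succ']

theorem analyticAt_lambert {τ z : ℂ} (hz : |z.im| < τ.im) :
    AnalyticAt ℂ (fun p : ℂ × ℂ => lambert (ex p.1) (ex p.2)) (τ, z) := by
  -- Choose `|Im z| < b < c < a < Im τ`. Inserting the weight `ρ^{n+1} ρ^{-n-1}` with `ρ = e^{2πc}`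
  -- bounds the factor in `τ` by a geometric series of ratio `e^{2π(c-a)}` and the factor in `z` by
  -- one of ratio `e^{2π(b-c)}`.
  obtain ⟨b, hzb, hb⟩ := exists_between hz
  obtain ⟨c, hbc, hc⟩ := exists_between hb
  obtain ⟨a, hca, ha⟩ := exists_between hc
  have hb0 : 0 < b := (abs_nonneg _).trans_lt hzb
  have hp := Real.pi_pos
  set X : ℝ → ℝ := fun t => Real.exp (2 * Real.pi * t) with hX
  have hXpos : ∀ t, 0 < X t := fun t => Real.exp_pos _
  have hXlt : ∀ {s t}, s < t → X s < X t := fun h => Real.exp_lt_exp.2 (by nlinarith)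
  set ρ : ℂ := (X c : ℂ) with hρ
  have hρ0 : ρ ≠ 0 := Complex.ofReal_ne_zero.2 (hXpos c).ne'
  have hρn : ‖ρ‖ = X c := by rw [hρ, Complex.norm_real, Real.norm_of_nonneg (hXpos c).le]
  have hU : IsOpen {x : ℂ | a < x.im} := isOpen_lt continuous_const Complex.continuous_im
  have hU' : IsOpen {y : ℂ | |y.im| < b} :=
    isOpen_lt (continuous_abs.comp Complex.continuous_im) continuous_const
  have hr1 : (X a)⁻¹ < 1 := inv_lt_one_of_one_lt₀ (Real.one_lt_exp_iff.2 (by nlinarith))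
  have hq : ∀ x ∈ {x : ℂ | a < x.im}, ‖ex x‖ ≤ (X a)⁻¹ := fun x hx => by
    rw [norm_ex, ← Real.exp_neg, Real.exp_le_exp]
    have : a < x.im := hx
    nlinarith
  have main := analyticAt_tsum_mul
    (f := fun n x => lam (ex x) n * ρ ^ (n + 1)) (g := fun n y => dif (ex y) n * (ρ ^ (n + 1))⁻¹)
    (A := fun n => (1 - (X a)⁻¹)⁻¹ * (X c / X a) ^ (n + 1))
    (B := fun n => 2 * (X b / X c) ^ (n + 1))
    (summable_geometric_succ (by positivity) ((div_lt_one (hXpos a)).2 (hXlt hca)) _)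
    (summable_geometric_succ (by positivity) ((div_lt_one (hXpos c)).2 (hXlt hbc)) _)
    hU hU'
    (fun n x hx => by
      have h1 := one_sub_pow_ne_zero ((hq x hx).trans_lt hr1) n
      have h2 : DifferentiableAt ℂ (fun x => ex x ^ (n + 1)) x := (differentiable_ex x).pow _
      exact ((h2.div ((differentiableAt_const 1).sub h2) h1).mul_const _).differentiableWithinAt)
    (fun n y _ => by
      have h2 : DifferentiableAt ℂ (fun x => ex x ^ (n + 1)) y := (differentiable_ex y).pow _
      exact ((h2.sub (h2.inv (pow_ne_zero _ (ex_ne_zero y)))).mul_const _).differentiableWithinAt)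
    (fun n x hx => by
      have := norm_lam_le (hq x hx) hr1 n
      rw [norm_mul, norm_pow, hρn, div_pow, div_eq_inv_mul, ← inv_pow, ← mul_assoc]
      gcongr)
    (fun n y hy => by
      have h1 := norm_ex_le (le_of_lt hy)
      have := norm_dif_le h1.1 h1.2 n
      rw [norm_mul, norm_inv, norm_pow, hρn, div_pow, div_eq_mul_inv, ← mul_assoc]
      gcongr)
    (x := τ) (y := z) ha hzb
  refine main.congr (Eventually.of_forall fun p => ?_)
  refine tsum_congr fun n => ?_
  have := pow_ne_zero (n + 1) hρ0
  field_simp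

theorem summable_lambert {τ z : ℂ} (hz : |z.im| < τ.im) :
    Summable fun n => lam (ex τ) n * dif (ex z) n := by
  have hp := Real.pi_pos
  have h0 : 0 < τ.im := (abs_nonneg _).trans_lt hz
  have h1 := norm_ex_le (le_refl |z.im|)
  refine Summable.of_norm_bounded (g := fun n => (1 - ‖ex τ‖)⁻¹ * 2 *
    (‖ex τ‖ * Real.exp (2 * Real.pi * |z.im|)) ^ (n + 1))
    (summable_geometric_succ (by positivity) ?_ _) fun n => ?_
  · rw [norm_ex, ← Real.exp_add, Real.exp_lt_one_iff]
    nlinarith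
  · have h2 := norm_lam_le (le_refl ‖ex τ‖) (norm_ex_lt_one h0) n
    have h3 := norm_dif_le h1.1 h1.2 n
    rw [norm_mul, mul_pow]
    calc _ ≤ _ := mul_le_mul h2 h3 (norm_nonneg _) ((norm_nonneg _).trans h2)
      _ = _ := by ring

/-- The function `ζ̄` on the strip `|Im z| < Im τ`. -/
def zetaStrip (q u : ℂ) : ℂ := 1 / 2 + u / (1 - u) + lambert q u

theorem hasSum_geometric_succ {w : ℂ} (hw : ‖w‖ < 1) :
    HasSum (fun n : ℕ => w ^ (n + 1)) (w / (1 - w)) := by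
  have := (hasSum_geometric_of_norm_lt_one hw).mul_left w
  simpa only [← pow_succ', ← div_eq_mul_inv] using this

/-- Replacing `u` by `qu` changes the `n`-th term of the Lambert sum by `-(qu)ⁿ - u⁻ⁿ`. The
hypotheses say `|qu| < 1` and `|u⁻¹| < 1`, so both geometric series converge. The first cancels
`qu/(1 - qu)`, and the second contributes `1/(1 - u) = u/(1 - u) + 1`. -/
theorem zetaStrip_shift {τ z : ℂ} (h1 : -τ.im < z.im) (h2 : z.im < 0) :
    zetaStrip (ex τ) (ex (z + τ)) = zetaStrip (ex τ) (ex z) + 1 := by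
  have h0 : 0 < τ.im := by linarith
  have hu0 := ex_ne_zero z
  have hw : ‖ex (z + τ)‖ < 1 := norm_ex_lt_one (by simp; linarith)
  have hu : ‖(ex z)⁻¹‖ < 1 := by
    rw [norm_inv, norm_ex, ← Real.exp_neg, Real.exp_lt_one_iff]
    nlinarith [Real.pi_pos]
  have hne : 1 - ex z ≠ 0 := by
    intro h
    rw [← sub_eq_zero.1 h] at hu
    simp at hu
  have hS := (summable_lambert (τ := τ) (z := z) (by rw [abs_lt]; constructor <;> linarith)).hasSum
  have hq := norm_ex_lt_one h0
  have key := (hS.sub (hasSum_geometric_succ hw)).sub (hasSum_geometric_succ hu)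
  have hterm : ∀ n, lam (ex τ) n * dif (ex (z + τ)) n =
      lam (ex τ) n * dif (ex z) n - ex (z + τ) ^ (n + 1) - (ex z)⁻¹ ^ (n + 1) := fun n => by
    have e1 := one_sub_pow_ne_zero hq n
    have e2 := pow_ne_zero (n + 1) hu0
    have e3 := pow_ne_zero (n + 1) (ex_ne_zero τ)
    rw [ex_add, lam, dif, dif, mul_pow, inv_pow]
    generalize ex z ^ (n + 1) = U at *
    generalize ex τ ^ (n + 1) = Q at *
    field_simp
    ring
  rw [zetaStrip, lambert, tsum_congr hterm, key.tsum_eq, zetaStrip, lambert]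
  have e : (ex z)⁻¹ / (1 - (ex z)⁻¹) = -(1 / (1 - ex z)) := by
    have : ex z - 1 ≠ 0 := fun h => hne (by linear_combination -h)
    field_simp
    ring
  have e' : ex z / (1 - ex z) = 1 / (1 - ex z) - 1 := by
    field_simp
    ring
  rw [e, e']
  ring

/-- The Taylor series at `z = 0` of the Lambert series with `q = e^{2πiτ}`, `u = e^{2πiz}`. -/
def lambertSeries (q : ℂ) : FormalO := PowerSeries.mk fun j =>
  (∑' n : ℕ, ((n : ℂ) + 1) ^ j * lam q n) *
    ((2 * Real.pi * Complex.I) ^ j * (1 - (-1) ^ j) / (j.factorial : ℂ))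

theorem dif_ex (z : ℂ) (n : ℕ) :
    dif (ex z) n = Complex.exp (((n : ℂ) + 1) * (2 * Real.pi * Complex.I * z)) -
      Complex.exp (-(((n : ℂ) + 1) * (2 * Real.pi * Complex.I * z))) := by
  have : ex z ^ (n + 1) = Complex.exp (((n : ℂ) + 1) * (2 * Real.pi * Complex.I * z)) := by
    rw [ex, ← Complex.exp_nat_mul]
    push_cast
    rfl
  rw [dif, this, ← Complex.exp_neg]

theorem hasSum_exp (w : ℂ) : HasSum (fun j : ℕ => w ^ j / (j.factorial : ℂ)) (Complex.exp w) := by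
  have := NormedSpace.expSeries_div_hasSum_exp w
  rwa [← Complex.exp_eq_exp_ℂ] at this

/-- Expand the exponentials in `uⁿ - u⁻ⁿ` and exchange the sums. The double series converges
absolutely for `|z| < Im τ`, where `|q| e^{2π|z|} < 1`. -/
theorem expandsPS_lambert {τ : ℂ} (hτ : 0 < τ.im) :
    ExpandsPS (fun z => lambert (ex τ) (ex z)) (lambertSeries (ex τ)) := by
  filter_upwards [Metric.ball_mem_nhds (0 : ℂ) hτ] with z hz
  rw [mem_ball_zero_iff] at hz
  have hp := Real.pi_pos
  have hq := norm_ex_lt_one hτ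
  have hqn := norm_ex τ
  generalize ex τ = q at hq hqn ⊢
  obtain ⟨w, hw⟩ : ∃ w : ℕ → ℂ, ∀ n : ℕ, w n = ((n : ℂ) + 1) * (2 * Real.pi * Complex.I * z) :=
    ⟨_, fun _ => rfl⟩
  have hwn : ∀ n, ‖w n‖ = (n + 1) * (2 * Real.pi * ‖z‖) := fun n => by
    have : ‖((n : ℂ) + 1)‖ = (n : ℝ) + 1 := by
      rw [← Nat.cast_succ, Complex.norm_natCast, Nat.cast_succ]
    rw [hw, norm_mul, this]
    simp [abs_of_pos hp]
  obtain ⟨F, hF⟩ : ∃ F : ℕ × ℕ → ℂ, ∀ n j, F (n, j) =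
      lam q n * (w n ^ j / (j.factorial : ℂ) - (-(w n)) ^ j / (j.factorial : ℂ)) :=
    ⟨fun x => lam q x.1 * (w x.1 ^ x.2 / (x.2.factorial : ℂ) -
      (-(w x.1)) ^ x.2 / (x.2.factorial : ℂ)), fun _ _ => rfl⟩
  have hexp : ∀ n, HasSum (fun j => ‖lam q n‖ * 2 * (‖w n‖ ^ j / (j.factorial : ℝ)))
      (‖lam q n‖ * 2 * Real.exp ‖w n‖) := fun n => by
    have := NormedSpace.expSeries_div_hasSum_exp ‖w n‖
    rw [← Real.exp_eq_exp_ℝ] at this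
    exact this.mul_left _
  have hFs : Summable F := by
    refine Summable.of_norm_bounded
      (g := fun x : ℕ × ℕ => ‖lam q x.1‖ * 2 * (‖w x.1‖ ^ x.2 / (x.2.factorial : ℝ))) ?_ ?_
    · rw [summable_prod_of_nonneg fun x => by positivity]
      refine ⟨fun n => (hexp n).summable, ?_⟩
      simp only [fun n => (hexp n).tsum_eq]
      refine Summable.of_nonneg_of_le (fun n => by positivity) (fun n => ?_)
        (summable_geometric_succ (r := ‖q‖ * Real.exp (2 * Real.pi * ‖z‖)) (by positivity) ?_
          ((1 - ‖q‖)⁻¹ * 2))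
      · have h2 := norm_lam_le (le_refl ‖q‖) hq n
        have h3 : Real.exp ‖w n‖ = Real.exp (2 * Real.pi * ‖z‖) ^ (n + 1) := by
          rw [hwn, ← Real.exp_nat_mul]
          push_cast
          rfl
        rw [h3, mul_pow]
        calc _ ≤ (1 - ‖q‖)⁻¹ * ‖q‖ ^ (n + 1) * 2 * Real.exp (2 * Real.pi * ‖z‖) ^ (n + 1) := by
              gcongr
          _ = _ := by ring
      · rw [hqn, ← Real.exp_add, Real.exp_lt_one_iff]
        nlinarith
    · rintro ⟨n, j⟩
      rw [hF, norm_mul, mul_assoc]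
      gcongr
      have h1 : ‖w n ^ j / (j.factorial : ℂ)‖ = ‖w n‖ ^ j / (j.factorial : ℝ) := by
        rw [norm_div, norm_pow, Complex.norm_natCast]
      have h2 : ‖(-(w n)) ^ j / (j.factorial : ℂ)‖ = ‖w n‖ ^ j / (j.factorial : ℝ) := by
        rw [norm_div, norm_pow, norm_neg, Complex.norm_natCast]
      linarith [norm_sub_le (w n ^ j / (j.factorial : ℂ)) ((-(w n)) ^ j / (j.factorial : ℂ))]
  have hrow : ∀ n, HasSum (fun j => F (n, j)) (lam q n * dif (ex z) n) := fun n => by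
    rw [dif_ex, ← hw n]
    exact (((hasSum_exp (w n)).sub (hasSum_exp (-(w n)))).mul_left (lam q n)).congr_fun (hF n)
  have htot := hFs.hasSum
  have hS := htot.prod_fiberwise hrow
  rw [lambert, hS.tsum_eq]
  have hswap := (Equiv.prodComm ℕ ℕ).hasSum_iff.2 htot
  refine hswap.prod_fiberwise fun j => ?_
  have hcol : Summable fun n => F (n, j) :=
    hFs.comp_injective (Prod.mk_left_injective j)
  have hval : ∀ n, F (n, j) = ((n : ℂ) + 1) ^ j * lam q n *
      ((2 * Real.pi * Complex.I) ^ j * (1 - (-1) ^ j) / (j.factorial : ℂ) * z ^ j) := fun n => by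
    simp only [hF, hw]
    rw [neg_pow (_ * _), mul_pow, mul_pow]
    ring
  have := hcol.hasSum
  simp only [hval, tsum_mul_right] at this
  rw [lambertSeries, PowerSeries.coeff_mk, mul_assoc]
  simpa only [Function.comp, Equiv.prodComm_apply, Prod.swap_prod_mk, hval] using this

/-- `1/2 + u/(1 - u) = -1/2 - 1/(u - 1)`. The bound `|z| < 1` excludes the other zeros of `e^{2πiz}
- 1`. -/
theorem zetaStrip_eq_todd {z : ℂ} (hz : z ≠ 0) (hz1 : ‖z‖ < 1) :
    z * (1 / 2 + ex z / (1 - ex z)) =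
      -(1 / 2) * z - (2 * Real.pi * Complex.I)⁻¹ * todd (2 * Real.pi * Complex.I * z) := by
  have h2 := Complex.two_pi_I_ne_zero
  have hne : ex z - 1 ≠ 0 := fun h => by
    obtain ⟨n, rfl⟩ := ex_eq_one_iff.1 (sub_eq_zero.1 h)
    rw [Complex.norm_intCast] at hz1
    have : |n| < 1 := by exact_mod_cast hz1
    exact hz (by rw [Int.abs_lt_one_iff.1 this]; simp)
  have hne' : 1 - ex z ≠ 0 := fun h => hne (by linear_combination -h)
  rw [todd_of_ne (mul_ne_zero h2 hz), ← ex]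
  field_simp
  ring

/-- The Taylor series at `z = 0` of `z ζ̄(z, τ)`, with `q = e^{2πiτ}`. -/
def zetaSeries (q : ℂ) : FormalO :=
  PowerSeries.C (-(1 / 2)) * PowerSeries.X - PowerSeries.C (2 * Real.pi * Complex.I)⁻¹ *
    PowerSeries.rescale (2 * Real.pi * Complex.I) (bernoulliPowerSeries ℂ) +
    PowerSeries.X * lambertSeries q

theorem expands_zetaStrip {τ : ℂ} (hτ : 0 < τ.im) :
    Expands (fun z => zetaStrip (ex τ) (ex z))
      (HahnSeries.single (-(1 : ℕ) : ℤ) 1 *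
        HahnSeries.ofPowerSeries ℤ ℂ (zetaSeries (ex τ))) := by
  have h := ((((ExpandsPS.const (-(1 / 2))).mul ExpandsPS.id).sub
    ((ExpandsPS.const (2 * Real.pi * Complex.I)⁻¹).mul
      (expandsPS_todd.rescale (2 * Real.pi * Complex.I)))).add
    (ExpandsPS.id.mul (expandsPS_lambert hτ)))
  refine h.expands ?_
  filter_upwards [self_mem_nhdsWithin, nhdsWithin_le_nhds (Metric.ball_mem_nhds (0 : ℂ) one_pos)]
    with z h0 h1
  rw [zetaStrip, pow_one, mul_add, zetaStrip_eq_todd h0 (mem_ball_zero_iff.1 h1)]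

/-! ### Comparison with the Eisenstein coefficients -/

theorem eisG_eq {k : ℕ} (hk : k ≠ 0) (τ : ℂ) :
    eisG k τ = (-1) ^ (k + 1) * (2 * Real.pi : ℂ) ^ (2 * k) / ((2 * k).factorial : ℂ) *
      (((bernoulli (2 * k) : ℚ) : ℂ) -
        4 * k * ∑' n : ℕ, ((n : ℂ) + 1) ^ (2 * k - 1) * lam (ex τ) n) := by
  -- Nonvanishing of `B_{2k}` cancels the denominator in `E_{2k}` against the prefactor of `G_{2k}`.
  have hB : ((bernoulli (2 * k) : ℚ) : ℂ) ≠ 0 := by exact_mod_cast bernoulli_two_mul_ne_zero hk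
  rw [eisG, eisE]
  simp only [lam, ex, mul_div_assoc]
  field_simp

theorem coeff_zetaSeries_zero (q : ℂ) :
    PowerSeries.coeff 0 (zetaSeries q) = (-(2 * Real.pi * Complex.I))⁻¹ := by
  rw [zetaSeries, map_add, map_sub, PowerSeries.coeff_zero_X_mul, PowerSeries.coeff_C_mul,
    PowerSeries.coeff_C_mul, PowerSeries.coeff_zero_X, PowerSeries.coeff_rescale,
    bernoulliPowerSeries, PowerSeries.coeff_mk]
  simp [inv_neg]

theorem coeff_zetaSeries_succ (q : ℂ) (j : ℕ) :
    PowerSeries.coeff (j + 1) (zetaSeries q) = (if j = 0 then -(1 / 2) else 0) -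
      (2 * Real.pi * Complex.I) ^ j *
        (((bernoulli (j + 1) : ℚ) : ℂ) / ((j + 1).factorial : ℂ)) +
      PowerSeries.coeff j (lambertSeries q) := by
  have h2 := Complex.two_pi_I_ne_zero
  rw [zetaSeries, map_add, map_sub, PowerSeries.coeff_succ_X_mul, PowerSeries.coeff_C_mul,
    PowerSeries.coeff_C_mul, PowerSeries.coeff_X, PowerSeries.coeff_rescale, bernoulliPowerSeries,
    PowerSeries.coeff_mk]
  simp only [add_eq_right, mul_ite, mul_one, mul_zero, pow_succ, eq_ratCast, Rat.cast_div,
    Rat.cast_natCast]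
  field_simp

theorem zetaBar_eq {τ : ℂ} : zetaBar τ = HahnSeries.single (-(1 : ℕ) : ℤ) 1 *
    HahnSeries.ofPowerSeries ℤ ℂ (zetaSeries (ex τ)) := by
  have h2 := Complex.two_pi_I_ne_zero
  set Q : FormalO := PowerSeries.mk fun j => if Odd j then eisG ((j + 1) / 2) τ else 0 with hQ
  have hz : zetaSeries (ex τ) =
      PowerSeries.C (-(2 * Real.pi * Complex.I))⁻¹ * (1 - PowerSeries.X * Q) := by
    ext n
    rw [PowerSeries.coeff_C_mul, map_sub]
    rcases n with _ | j
    · rw [coeff_zetaSeries_zero]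
      simp
    rw [coeff_zetaSeries_succ, PowerSeries.coeff_succ_X_mul, PowerSeries.coeff_one,
      if_neg j.succ_ne_zero, hQ, PowerSeries.coeff_mk, lambertSeries, PowerSeries.coeff_mk]
    rcases Nat.even_or_odd j with he | ho
    · rw [if_neg (Nat.not_odd_iff_even.2 he), he.neg_one_pow]
      -- For even `j` the Lambert coefficient vanishes. At `j = 0` the term `-1/2` cancels `B₁ =
      -- -1/2`, which is why `zetaStrip` contains the constant `1/2`. For `j > 0` the odd-index
      -- Bernoulli number is zero.
      rcases eq_or_ne j 0 with rfl | hj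
      · norm_num [bernoulli_one]
      · rw [bernoulli_eq_zero_of_odd he.add_one (by lia), if_neg hj]
        simp
    · obtain ⟨m, rfl⟩ := ho
      rw [if_pos (odd_two_mul_add_one m), if_neg (by lia), show (2 * m + 1 + 1) / 2 = m + 1 by lia,
        eisG_eq m.succ_ne_zero, show 2 * (m + 1) - 1 = 2 * m + 1 by lia,
        show 2 * (m + 1) = 2 * m + 1 + 1 by ring, Nat.factorial_succ (2 * m + 1),
        (odd_two_mul_add_one m).neg_one_pow]
      generalize ∑' n : ℕ, ((n : ℂ) + 1) ^ (2 * m + 1) * lam (ex τ) n = T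
      generalize ((bernoulli (2 * m + 1 + 1) : ℚ) : ℂ) = B
      -- The sign `(-1)^k` in `G_{2k}` is that of `(2πi)^{2k}`, here with `k = m + 1`.
      have hI : (2 * Real.pi * Complex.I : ℂ) ^ (2 * m + 1) * (2 * Real.pi * Complex.I) =
          (-1) ^ (m + 1) * (2 * Real.pi : ℂ) ^ (2 * m + 1 + 1) := by
        rw [← pow_succ, mul_pow, show 2 * m + 1 + 1 = 2 * (m + 1) by ring, pow_mul Complex.I,
          Complex.I_sq, mul_comm]
      have hf : ((2 * m + 1).factorial : ℂ) ≠ 0 := by exact_mod_cast Nat.factorial_ne_zero _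
      have hm : ((2 * m + 1 : ℕ) : ℂ) + 1 ≠ 0 := Nat.cast_add_one_ne_zero _
      refine mul_right_cancel₀ h2 ?_
      have e : (-1 : ℂ) ^ (m + 1 + 1) = -(-1) ^ (m + 1) := by rw [pow_succ]; ring
      rw [inv_neg, e]
      generalize (2 * Real.pi : ℂ) ^ (2 * m + 1 + 1) = P at *
      generalize (-1 : ℂ) ^ (m + 1) = S at *
      generalize (2 * Real.pi * Complex.I : ℂ) ^ (2 * m + 1) = R at *
      rw [Nat.cast_mul, Nat.cast_succ (2 * m + 1)]
      generalize ((2 * m + 1).factorial : ℂ) = N at *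
      have hmm : ((m + 1 : ℕ) : ℂ) * 4 = 2 * (((2 * m + 1 : ℕ) : ℂ) + 1) := by push_cast; ring
      rw [show (4 : ℂ) * ((m + 1 : ℕ) : ℂ) = ((m + 1 : ℕ) : ℂ) * 4 by ring, hmm]
      generalize ((2 * m + 1 : ℕ) : ℂ) + 1 = K at *
      trans (R * (2 * Real.pi * Complex.I)) * (2 * T / N - B / (K * N))
      · ring
      · rw [hI]
        generalize (2 * Real.pi * Complex.I : ℂ) = D at *
        field_simp
        ring
  have hs : (HahnSeries.single (-(1 : ℕ) : ℤ) 1 * HahnSeries.single (1 : ℤ) 1 : FormalK) = 1 := by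
    simp [HahnSeries.single_mul_single]
  have h1 : HahnSeries.ofPowerSeries ℤ ℂ (1 : FormalO) = 1 := map_one _
  rw [hz, zetaBar, ← hQ, RingHom.map_mul, RingHom.map_sub, RingHom.map_mul, h1,
    HahnSeries.ofPowerSeries_C, HahnSeries.ofPowerSeries_X, ← HahnSeries.C_mul_eq_smul,
    mul_left_comm, mul_sub, mul_sub (HahnSeries.single (-(1 : ℕ) : ℤ) 1),
    ← mul_assoc (HahnSeries.single (-(1 : ℕ) : ℤ) 1), hs, mul_one, one_mul, mul_sub]
  rfl

/-! ### The function `ζ̄` on the family of curves -/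

/-- The function `ζ̄(z, τ)`, continued from the strip `|Im z| < Im τ` by quasi-periodicity. -/
def zetaFun (τ z : ℂ) : ℂ :=
  zetaStrip (ex τ) (ex (z - ⌊z.im / τ.im⌋ * τ)) + ⌊z.im / τ.im⌋

/-- The strip has width `2 Im τ`, so the floor is either `m` or `m - 1`, and the shift relation
identifies the two values. Any admissible `m` may thus be used, which hides the discontinuity of the
floor. -/
theorem zetaFun_eq {τ z : ℂ} (hτ : 0 < τ.im) {m : ℤ} (hm : |(z - m * τ).im| < τ.im) :
    zetaFun τ z = zetaStrip (ex τ) (ex (z - m * τ)) + m := by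
  have him : (z - m * τ).im = (z.im / τ.im - m) * τ.im := by
    have : (z - m * τ).im = z.im - m * τ.im := by simp
    rw [this, sub_mul, div_mul_cancel₀ _ hτ.ne']
  have hlt : |z.im / τ.im - m| < 1 := by
    rw [him, abs_mul, abs_of_pos hτ] at hm
    exact lt_of_mul_lt_mul_right (by simpa using hm) hτ.le
  obtain ⟨h1, h2⟩ := abs_lt.1 hlt
  have hfl := Int.floor_le (z.im / τ.im)
  have hfl' := Int.lt_floor_add_one (z.im / τ.im)
  rw [zetaFun]
  generalize ⌊z.im / τ.im⌋ = a at *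
  have ha1 : a < m + 1 := by
    have : (a : ℝ) < m + 1 := by linarith
    exact_mod_cast this
  have ha2 : m - 1 < a + 1 := by
    have : (m : ℝ) - 1 < a + 1 := by linarith
    exact_mod_cast this
  obtain rfl | rfl : a = m ∨ a = m - 1 := by lia
  · rfl
  · push_cast at hfl'
    have hneg : (z - m * τ).im < 0 := by
      rw [him]
      exact mul_neg_of_neg_of_pos (by linarith) hτ
    have hgt : -τ.im < (z - m * τ).im := (abs_lt.1 hm).1
    have := zetaStrip_shift hgt hneg
    rw [show z - m * τ + τ = z - ((m - 1 : ℤ) : ℂ) * τ by push_cast; ring] at this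
    rw [this]
    push_cast
    ring

theorem zetaFun_add {τ : ℂ} (hτ : 0 < τ.im) (z : ℂ) (m n : ℤ) :
    zetaFun τ (z + m * τ + n) = zetaFun τ z + m := by
  have h1 : (z + m * τ + n).im / τ.im = z.im / τ.im + m := by
    simp only [Complex.add_im, Complex.mul_im, Complex.intCast_re, Complex.intCast_im, zero_mul,
      add_zero]
    field_simp
  rw [zetaFun, zetaFun, h1, Int.floor_add_intCast]
  rw [show z + m * τ + n - ((⌊z.im / τ.im⌋ + m : ℤ) : ℂ) * τ =
    (z - (⌊z.im / τ.im⌋ : ℂ) * τ) + n by push_cast; ring, ex_add, ex_intCast, mul_one]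
  push_cast
  ring

theorem isOpen_strip (m : ℤ) : IsOpen {p : ℂ × ℂ | |(p.2 - m * p.1).im| < p.1.im} :=
  isOpen_lt (by fun_prop) (by fun_prop)

theorem pos_im_of_strip {p : ℂ × ℂ} {m : ℤ} (h : |(p.2 - m * p.1).im| < p.1.im) : 0 < p.1.im :=
  (abs_nonneg _).trans_lt h

theorem differentiableAt_zetaFun {τ z : ℂ} (hτ : 0 < τ.im) (hz : z ∉ lattice τ) :
    DifferentiableAt ℂ (fun p : ℂ × ℂ => zetaFun p.1 p.2) (τ, z) := by
  set m := ⌊z.im / τ.im⌋ with hm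
  have hstrip : |(z - m * τ).im| < τ.im := by
    have h1 := Int.floor_le (z.im / τ.im)
    have h2 := Int.lt_floor_add_one (z.im / τ.im)
    rw [← hm] at h1 h2
    rw [le_div_iff₀ hτ] at h1
    rw [div_lt_iff₀ hτ] at h2
    have h3 : (z - m * τ).im = z.im - m * τ.im := by simp
    rw [h3, abs_lt]
    constructor <;> linarith
  -- Keep the integer fixed at its value at `(τ, z)`. The strip condition is open, so the same
  -- formula is valid at all nearby points.
  have hloc : (fun p : ℂ × ℂ => zetaFun p.1 p.2) =ᶠ[𝓝 (τ, z)]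
      fun p => zetaStrip (ex p.1) (ex (p.2 - m * p.1)) + m := by
    filter_upwards [(isOpen_strip m).mem_nhds (show (τ, z) ∈ _ from hstrip)] with p hp
    exact zetaFun_eq (pos_im_of_strip hp) hp
  refine DifferentiableAt.congr_of_eventuallyEq ?_ hloc
  have hne : 1 - ex (z - m * τ) ≠ 0 := fun h => by
    obtain ⟨n, hn⟩ := ex_eq_one_iff.1 (sub_eq_zero.1 h).symm
    exact hz ⟨m, n, by linear_combination hn⟩
  have hmap : DifferentiableAt ℂ (fun p : ℂ × ℂ => (p.1, p.2 - m * p.1)) (τ, z) := by fun_prop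
  have hu : DifferentiableAt ℂ (fun p : ℂ × ℂ => ex (p.2 - m * p.1)) (τ, z) :=
    (differentiable_ex _).comp (τ, z) (by fun_prop : DifferentiableAt ℂ
      (fun p : ℂ × ℂ => p.2 - m * p.1) (τ, z))
  have hL : DifferentiableAt ℂ (fun p : ℂ × ℂ => lambert (ex p.1) (ex (p.2 - m * p.1))) (τ, z) :=
    DifferentiableAt.comp (g := fun p : ℂ × ℂ => lambert (ex p.1) (ex p.2)) (τ, z)
      (analyticAt_lambert hstrip).differentiableAt hmap
  have hD : DifferentiableAt ℂ
      (fun p : ℂ × ℂ => ex (p.2 - m * p.1) / (1 - ex (p.2 - m * p.1))) (τ, z) :=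
    DifferentiableAt.comp (g := fun u : ℂ => u / (1 - u)) (τ, z)
      (differentiableAt_id.fun_div ((differentiableAt_const 1).fun_sub differentiableAt_id) hne) hu
  exact ((hD.const_add (1 / 2)).fun_add hL).add_const _

theorem eventually_zetaFun_eq {τ : ℂ} (hτ : 0 < τ.im) :
    ∀ᶠ p in 𝓝 (τ, (0 : ℂ)), zetaFun p.1 p.2 = zetaStrip (ex p.1) (ex p.2) := by
  have hmem : (τ, (0 : ℂ)) ∈ {p : ℂ × ℂ | |(p.2 - (0 : ℤ) * p.1).im| < p.1.im} := by
    simpa using hτ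
  filter_upwards [(isOpen_strip 0).mem_nhds hmem] with p hp
  simpa using zetaFun_eq (pos_im_of_strip hp) hp

theorem isVectorField_zetaFun : IsVectorField upperHalf (fun _ => 1) zetaFun where
  holo_base := differentiableOn_const 1
  holo_vert p hp := (differentiableAt_zetaFun hp.1 hp.2).differentiableWithinAt
  invariant τ hτ z _ m n := by
    rw [fderiv_deck_apply]
    simp only [deck]
    rw [zetaFun_add hτ, mul_one]
  meromorphic τ hτ := by
    refine ⟨1, fun p => -(1 / 2) * p.2 - (2 * Real.pi * Complex.I)⁻¹ *
      todd (2 * Real.pi * Complex.I * p.2) + p.2 * lambert (ex p.1) (ex p.2), ?_, ?_⟩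
    · have h1 : AnalyticAt ℂ (fun p : ℂ × ℂ => todd (2 * Real.pi * Complex.I * p.2)) (τ, 0) :=
        analyticAt_todd.comp_of_eq (analyticAt_const.mul analyticAt_snd) (by simp)
      have h2 := analyticAt_lambert (τ := τ) (z := 0) 
        (by rw [Complex.zero_im, abs_zero]; exact hτ)
      exact ((analyticAt_const.mul analyticAt_snd).sub (analyticAt_const.mul h1)).add
        (analyticAt_snd.mul h2)
    · have hball : ∀ᶠ p in 𝓝 (τ, (0 : ℂ)), ‖p.2‖ < 1 :=
        (isOpen_lt (by fun_prop) continuous_const).mem_nhds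
          (show (τ, (0 : ℂ)) ∈ {p : ℂ × ℂ | ‖p.2‖ < 1} by simp)
      filter_upwards [eventually_zetaFun_eq hτ, hball] with p hp h1 h0
      rw [pow_one, hp, zetaStrip, mul_add, zetaStrip_eq_todd h0 h1]

theorem expands_zetaFun {τ : ℂ} (hτ : τ ∈ upperHalf) : Expands (zetaFun τ) (zetaBar τ) := by
  rw [zetaBar_eq]
  refine (expands_zetaStrip hτ).congr ?_
  filter_upwards [(tendsto_prodMk_zero τ).eventually (eventually_zetaFun_eq hτ)] with z hz
  exact hz.symm

theorem isLift_zetaBar : IsLift upperHalf (fun _ => 1) zetaBar :=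
  ⟨zetaFun, isVectorField_zetaFun, fun _ hτ => expands_zetaFun hτ⟩

end HarishChandra

end

theorem lemma6p1 (V : Type*) [AddCommGroup V] [Module ℂ V] [LieRingModule DerK V]
    [LieModule ℂ DerK V] [DistribMulAction AutO V] [SMulCommClass AutO ℂ V] [IsHCModule V] :
    (∃ h : ℂ → ℂ → ℂ, IsVectorField upperHalf (fun _ => 1) h ∧
      ∀ τ ∈ upperHalf, Expands (h τ) (zetaBar τ)) ∧
    ∀ U : Set ℂ, IsOpen U → U ⊆ upperHalf → ∀ σ : DeltaSection V U,
      (σ.IsFlat ↔ ∀ (τ : U) (s : ℂ → V)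
        (hs : ((fun x => frame V (s x) : ℂ → Assoc V) : Germ (𝓝 (τ : ℂ)) (Assoc V)) ∈
          holGerm (Assoc V) (τ : ℂ)),
        σ.germ τ = DeltaStalk.mk (τ : ℂ) (fun x => frame V (s x)) hs →
        ∃ hs' : ((fun x => frame V (vderiv s x - resL (zetaBar x) (s x)) : ℂ → Assoc V) :
            Germ (𝓝 (τ : ℂ)) (Assoc V)) ∈ holGerm (Assoc V) (τ : ℂ),
          DeltaStalk.mk (τ : ℂ)
            (fun x => frame V (vderiv s x - resL (zetaBar x) (s x))) hs' = 0) :=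
  ⟨⟨zetaFun, isVectorField_zetaFun, fun _ hτ => expands_zetaFun hτ⟩,
    fun _ _ hU σ => isFlat_iff isLift_zetaBar hU σ⟩
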